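/- All logarithms are to base $2$, and $H(p)=p\log\frac1p+(1-p)\log\frac1{1-p}$. For strings $x,y$ over $\{0,1\}=\mathbb F_2$ let $d_e(x,y)$ be the minimum number of insertions and deletions that change $x$ into $y$, and let $B_b(v,r)=\{w\in\{0,1\}^b: d_e(w,v)\le r\}$ for $v\in\{0,1\}^*$. A sequence $\mathbf S_1,\dots,\mathbf S_n\in\mathbb F_2^{a\times b}$ is called $(\delta,l,L)$-sync if 1. there are no indices $1\le i_1<\dots<i_{l+1}\le n$, non-zero row vectors $x_1,\dots,x_{l+1}\in\mathbb F_2^a$ and $v\in\{0,1\}^*$ with $x_j\mathbf S_{i_j}\in B_b(v,\delta b)$ for all $j\in[l+1]$; 2. for every $i\in[n]$ and every $v\in\{0,1\}^*$, at most $L$ elements of the row space of $\mathbf S_i$ lie in $B_b(v,\delta b)$; 3. every $\mathbf S_i$ has full rank. **Corollary.** Let $\delta\in(0,1/2)$, let $l$ be a positive integer, and put $L=2^{l+1}$ and $R=1-\frac{2}{l+1}-5H(\delta)$. There is a deterministic algorithm (a Turing machine with finitely many stacks, depending only on $\delta$ and $l$) such that for every constant $C$ there is a polynomial $p$ with the following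 property: for all integers $n\ge1$ and $a,b\ge0$ with $$4(l+1)\log n\le b\le C\log n\qquad\text{and}\qquad a\le Rb,$$ the algorithm, given $n,a,b$ (in unary), outputs within $p(n)$ steps a $(\delta,l,L)$-sync sequence $\mathbf S_1,\dots,\mathbf S_n$ of matrices in $\mathbb F_2^{a\times b}$. -/

import Mathlib

namespace SyncSeq

/-! ### Edit distance (insertions and deletions only) -/

/-- `EditStep x y`: the string `y` arises from `x` by one insertion or one deletion. -/
inductive EditStep {α : Type} : List α → List α → Prop
  | ins (u v : List α) (c : α) : EditStep (u ++ v) (u ++ c :: v)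
  | del (u v : List α) (c : α) : EditStep (u ++ c :: v) (u ++ v)

/-- `EditChain k x y`: the string `y` arises from `x` by `k` successive insertions/deletions. -/
inductive EditChain {α : Type} : ℕ → List α → List α → Prop
  | nil (x : List α) : EditChain 0 x x
  | cons {k : ℕ} {x y z : List α} : EditStep x y → EditChain k y z → EditChain (k + 1) x z

/-- The minimum number of insertions and deletions needed to change `x` into `y`. -/
noncomputable def editDist {α : Type} (x y : List α) : ℕ :=
  sInf {k | EditChain k x y}

/-- Any string can be changed into any other one, so the minimum in `editDist` is over a
nonempty set. -/
theorem exists_editChain {α : Type} (x y : List α) : ∃ k, EditChain k x y := by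
  induction x with
  | nil =>
    have key : ∀ (w v : List α), ∃ k, EditChain k v (w ++ v) := by
      intro w
      induction w using List.reverseRecOn with
      | nil => exact fun v => ⟨0, EditChain.nil v⟩
      | append_singleton w c ih =>
        intro v
        obtain ⟨k, hk⟩ := ih (c :: v)
        refine ⟨k + 1, EditChain.cons (EditStep.ins [] v c) ?_⟩
        simpa using hk
    simpa using key y []
  | cons c x ih =>
    obtain ⟨k, hk⟩ := ih
    exact ⟨k + 1, EditChain.cons (EditStep.del [] x c) hk⟩

theorem editChain_editDist {α : Type} (x y : List α) : EditChain (editDist x y) x y :=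
  Nat.sInf_mem (exists_editChain x y)

/-! ### Sync sequences of binary matrices -/

/-- `B_b(v, r)`: the vectors of length `b` whose edit distance to the string `v`
(of arbitrary length) is at most `r`. -/
def editBall (b : ℕ) (v : List (ZMod 2)) (r : ℝ) : Set (Fin b → ZMod 2) :=
  {w | (editDist (List.ofFn w) v : ℝ) ≤ r}

/-- The linear code generated by `S`, i.e. its row space `{x S}`. -/
def rowCode {a b : ℕ} (S : Matrix (Fin a) (Fin b) (ZMod 2)) : Set (Fin b → ZMod 2) :=
  {w | ∃ x : Fin a → ZMod 2, w = Matrix.vecMul x S}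

/-- `(δ, L)`-list decodability with respect to edits. -/
def ListDecodable {b : ℕ} (δ : ℝ) (L : ℕ) (C : Set (Fin b → ZMod 2)) : Prop :=
  ∀ y : List (ZMod 2), (editBall b y (δ * b) ∩ C).ncard ≤ L

/-- `(δ, l)`-sync: no string `v` is within distance `δ b` of nonzero-message codewords of
`l + 1` codes with distinct indices. -/
def IsSyncPair {n a b : ℕ} (δ : ℝ) (l : ℕ)
    (S : Fin n → Matrix (Fin a) (Fin b) (ZMod 2)) : Prop :=
  ¬ ∃ (i : Fin (l + 1) → Fin n) (x : Fin (l + 1) → Fin a → ZMod 2) (v : List (ZMod 2)),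
      StrictMono i ∧ (∀ j, x j ≠ 0) ∧
        ∀ j, Matrix.vecMul (x j) (S (i j)) ∈ editBall b v (δ * b)

/-- `(δ, l, L)`-sync sequences of `a × b` matrices over `𝔽₂`. -/
structure IsSync {n a b : ℕ} (δ : ℝ) (l L : ℕ)
    (S : Fin n → Matrix (Fin a) (Fin b) (ZMod 2)) : Prop where
  sync : IsSyncPair δ l S
  listDecodable : ∀ i, ListDecodable δ L (rowCode (S i))
  fullRank : ∀ i, (S i).rank = min a b

/-- The binary entropy function with logarithms to base 2. -/
noncomputable def entropy₂ (p : ℝ) : ℝ :=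
  p * Real.logb 2 (1 / p) + (1 - p) * Real.logb 2 (1 / (1 - p))

/-! ### Encodings of the input and the output, and the machine model -/

/-- The input `(n, a, b)`, written as `1ⁿ 0 1ᵃ 0 1ᵇ`. -/
def encodeInput (n a b : ℕ) : List Bool :=
  List.replicate n true ++ false :: (List.replicate a true ++ false :: List.replicate b true)

/-- A sequence of `n` matrices of size `a × b`, written as the string of its `n a b` entries:
matrix after matrix, and row after row in each matrix. -/
def encodeMatrices {n a b : ℕ} (S : Fin n → Matrix (Fin a) (Fin b) (ZMod 2)) : List Bool :=
  (List.ofFn fun i : Fin n =>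
    (List.ofFn fun r : Fin a =>
      List.ofFn fun c : Fin b => decide (S i r c = 1)).flatten).flatten

/-- On the input `u`, the deterministic multi-stack Turing machine `M` halts within `t` steps
with the output `w`. -/
def HaltsWithin (M : Turing.TM2ComputableAux Bool Bool) (u w : List Bool) (t : ℕ) : Prop :=
  Nonempty (Turing.TM2OutputsInTime M.tm (u.map M.inputAlphabet.symm)
    (some (w.map M.outputAlphabet.symm)) t)

end SyncSeq

/-! The matrices come from a short seed found by exhaustive search; existence of a good seed is a
union bound over explicit codes with limited independence. Fix a generator `g` of the units of the
field with `2 ^ b` elements, and let the codeword of a message `X` in the `i`-th code be `∑ γ_q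
(g^i)^q X + ∑ γ'_t X^(2^t)` with `q, t ≤ l`. This is linear over `𝔽₂` in `X`. For distinct indices
and nonzero messages, `l + 1` codewords are an invertible (scaled Vandermonde) function of `γ` up to
a shift depending on `γ'`; for one index and linearly independent messages, they are an invertible
(Moore) function of `γ'` up to a shift. In both cases the codewords are jointly uniform. A list of
more than `2 ^ (l + 1)` messages always contains `l + 1` independent ones, which explains `L`.

The arbitrary centre `v` is removed first: two words of length `b` within distance `k` of the same
string share a subsequence of length `b - k`. It therefore suffices to control, for each word `w` of
length `b`, the codewords sharing such a subsequence with `w`. Choosing the subsequence and then a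
supersequence of it shows that there are at most `2 ^ (2 H(p) b)` such words when `k ≤ p b` and `p ≤
1/2` (`card_subBall_le`). With `H(p) ≤ 2 H(δ)`, the bounds on `a` and `n` make the expected number
of violations less than one (`union_bound_lt`, `exists_avoiding`).

The algorithm does no field arithmetic. A field element `y` is stored as the first `b` terms of the
sequence `k ↦ fn (y * g ^ k)`, which a linear feedback shift register continues, so multiplying by a
power of `g` amounts to reading later output. The feedback is itself a digit of the seed and is
searched for together with the coefficients. There are `(2 ^ b) ^ (2 l + 3)` seeds, each checked by
bounded quantifiers over words, messages and subsequences; all this is polynomial in `n` because `2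
^ b ≤ n ^ ⌈C⌉` (`exists_goodSeed`, `isSync_of_goodSeed`, `two_pow_le_of_le_log`).

For the running time, functions are built from unary counters by composition and polynomially
bounded recursion (`PB.letIn`, `PB.natRec`), and the resulting structured programs are compiled to a
multi-stack machine step for step (`steps_of_exec`). -/

namespace SyncSeq

/-! ### A structured language for machines with unary counters -/

/-- Programs acting on counters, an input stack and an output stack. -/
inductive Prog : Type
  | skip : Prog
  | inc (k : ℕ) : Prog
  | seq (P Q : Prog) : Prog
  /-- While counter `k` is positive, decrement it and run `P`. -/
  | loop (k : ℕ) (P : Prog) : Prog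
  /-- Pop the input stack; as long as the popped symbol is `true`, run `P` and repeat. -/
  | read (P : Prog) : Prog
  /-- Write whether counter `k` is positive, and decrement it. -/
  | emit (k : ℕ) : Prog

/-- The store of a program: input stack, output stack, counters. -/
structure Store where
  inp : List Bool
  out : List Bool
  reg : ℕ → ℕ

namespace Store

/-- Overwrite one counter. -/
def set (s : Store) (k v : ℕ) : Store := { s with reg := Function.update s.reg k v }

@[simp] theorem set_inp (s : Store) (k v : ℕ) : (s.set k v).inp = s.inp := rfl

@[simp] theorem set_out (s : Store) (k v : ℕ) : (s.set k v).out = s.out := rfl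

@[simp] theorem set_reg_same (s : Store) (k v : ℕ) : (s.set k v).reg k = v := by simp [set]

theorem set_reg_ne (s : Store) {j k : ℕ} (v : ℕ) (h : j ≠ k) : (s.set k v).reg j = s.reg j := by
  simp [set, h]

theorem set_reg_apply (s : Store) (j k v : ℕ) :
    (s.set k v).reg j = if j = k then v else s.reg j := by
  simp [set, Function.update_apply]

@[simp] theorem set_self (s : Store) (k : ℕ) : s.set k (s.reg k) = s := by
  simp [set]

@[simp] theorem set_set (s : Store) (k v w : ℕ) : (s.set k v).set k w = s.set k w := by
  simp [set]

theorem ext_reg {s t : Store} (hi : s.inp = t.inp) (ho : s.out = t.out)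
    (hr : ∀ j, s.reg j = t.reg j) : s = t := by
  cases s; cases t; simp_all; exact funext hr

end Store

/-- `Exec P s t s'`: started on `s`, the program `P` ends on `s'` after `t` steps. -/
inductive Exec : Prog → Store → ℕ → Store → Prop
  | skip (s) : Exec .skip s 1 s
  | inc (k s) : Exec (.inc k) s 1 (s.set k (s.reg k + 1))
  | seq {P Q s s' s'' t t'} : Exec P s t s' → Exec Q s' t' s'' → Exec (.seq P Q) s (1 + t + t') s''
  | loop_zero {k P s} : s.reg k = 0 → Exec (.loop k P) s 1 s
  | loop_succ {k P s s' s'' v t t'} : s.reg k = v + 1 → Exec P (s.set k v) t s' →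
      Exec (.loop k P) s' t' s'' → Exec (.loop k P) s (1 + t + t') s''
  | read_nil {P s} : s.inp = [] → Exec (.read P) s 1 s
  | read_false {P s r} : s.inp = false :: r → Exec (.read P) s 1 { s with inp := r }
  | read_true {P s s' s'' r t t'} : s.inp = true :: r → Exec P { s with inp := r } t s' →
      Exec (.read P) s' t' s'' → Exec (.read P) s (1 + t + t') s''
  | emit (k s) : Exec (.emit k) s 1
      { (s.set k (s.reg k - 1)) with out := decide (0 < s.reg k) :: s.out }

/-! ### Compilation to a multi-stack machine -/

namespace Prog

/-- A strict upper bound for the counters that a program mentions. -/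
def width : Prog → ℕ
  | skip => 0
  | inc k => k + 1
  | seq P Q => max P.width Q.width
  | loop k P => max (k + 1) P.width
  | read P => P.width
  | emit k => k + 1

/-- The continuations met while `P` runs in front of the continuation `κ`. -/
def conts : Prog → List Prog → Set (List Prog)
  | skip, κ => {skip :: κ}
  | inc k, κ => {inc k :: κ}
  | seq P Q, κ => insert (seq P Q :: κ) (P.conts (Q :: κ) ∪ Q.conts κ)
  | loop k P, κ => insert (loop k P :: κ) (P.conts (loop k P :: κ))
  | read P, κ => insert (read P :: κ) (P.conts (read P :: κ))
  | emit k, κ => {emit k :: κ}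

/-- Programs have no recursive calls, so the pending continuation is determined by a position in the
syntax tree. It can thus live in the finite control instead of on a stack. -/
theorem finite_conts (P : Prog) (κ : List Prog) : (P.conts κ).Finite := by
  induction P generalizing κ with
  | skip => exact Set.finite_singleton _
  | inc k => exact Set.finite_singleton _
  | seq P Q ihP ihQ => exact ((ihP _).union (ihQ _)).insert _
  | loop k P ih => exact (ih _).insert _
  | read P ih => exact (ih _).insert _
  | emit k => exact Set.finite_singleton _

theorem self_mem_conts (P : Prog) (κ : List Prog) : P :: κ ∈ P.conts κ := by
  cases P <;> simp [conts]

/-- The labels of the machine that runs `P`. -/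
def labels (P : Prog) : Set (List Prog) := insert [] (P.conts [])

theorem finite_labels (P : Prog) : P.labels.Finite := (P.finite_conts []).insert _

open Classical in
/-- The label of a continuation. -/
noncomputable def lab (P : Prog) (κ : List Prog) : P.labels :=
  if h : κ ∈ P.labels then ⟨κ, h⟩ else ⟨[], Set.mem_insert _ _⟩

theorem coe_lab {P : Prog} {κ : List Prog} (h : κ ∈ P.labels) : (P.lab κ : List Prog) = κ := by
  simp [lab, h]

/-- Stack indices: input, output, and one stack for each counter. -/
abbrev Idx (m : ℕ) : Type := Bool ⊕ Fin m

/-- The stack that holds counter `k`. -/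
def stackOf (m k : ℕ) : Idx m := if h : k < m then .inr ⟨k, h⟩ else .inl true

/-- The machine code of a continuation. -/
noncomputable def code (P : Prog) : List Prog →
    Turing.TM2.Stmt (fun _ : Idx P.width => Bool) P.labels (Option Bool)
  -- A halting configuration in the sense of `Turing.haltList` must carry the initial internal
  -- state, hence the reset.
  | [] => .load (fun _ => none) .halt
  | skip :: κ => .goto fun _ => P.lab κ
  | inc k :: κ => .push (stackOf _ k) (fun _ => true) (.goto fun _ => P.lab κ)
  | seq Q R :: κ => .goto fun _ => P.lab (Q :: R :: κ)
  | loop k Q :: κ => .pop (stackOf _ k) (fun _ o => o) (.branch (fun o => o.isSome)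
      (.goto fun _ => P.lab (Q :: loop k Q :: κ)) (.goto fun _ => P.lab κ))
  | read Q :: κ => .pop (.inl false) (fun _ o => o) (.branch (fun o => o == some true)
      (.goto fun _ => P.lab (Q :: read Q :: κ)) (.goto fun _ => P.lab κ))
  | emit k :: κ => .pop (stackOf _ k) (fun _ o => o) (.push (.inl true) (fun o => o.isSome)
      (.goto fun _ => P.lab κ))

/-- The multi-stack machine that runs `P`. -/
noncomputable def machine (P : Prog) : Turing.FinTM2 where
  K := Idx P.width
  k₀ := .inl false
  k₁ := .inl true
  Γ := fun _ => Bool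
  Λ := P.labels
  main := P.lab [P]
  ΛFin := P.finite_labels.fintype
  σ := Option Bool
  initialState := none
  m := fun κ => P.code κ

/-- The stack contents that represent a store. -/
def contents (m : ℕ) (s : Store) : Idx m → List Bool
  | .inl false => s.inp
  | .inl true => s.out
  | .inr k => List.replicate (s.reg k) true

theorem contents_stackOf {m k : ℕ} (h : k < m) (s : Store) :
    contents m s (stackOf m k) = List.replicate (s.reg k) true := by
  simp [stackOf, h, contents]

theorem update_contents {m k : ℕ} (h : k < m) (s : Store) (v : ℕ) :
    Function.update (contents m s) (stackOf m k) (List.replicate v true) = contents m (s.set k v) := by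
  funext x
  rcases x with (_ | _) | x
  · simp [stackOf, h, contents]
  · simp [stackOf, h, contents]
  · by_cases hx : x = ⟨k, h⟩
    · subst hx; simp [stackOf, h, contents]
    · have : (x : ℕ) ≠ k := fun e => hx (Fin.ext e)
      simp [stackOf, h, contents, hx, Store.set_reg_apply, this]

theorem update_contents_inp {m : ℕ} (s : Store) (r : List Bool) :
    Function.update (contents m s) (.inl false) r = contents m { s with inp := r } := by
  funext x
  rcases x with (_ | _) | x <;> simp [contents]

theorem update_contents_out {m : ℕ} (s : Store) (r : List Bool) :
    Function.update (contents m s) (.inl true) r = contents m { s with out := r } := by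
  funext x
  rcases x with (_ | _) | x <;> simp [contents]

/-- The machine of `P`, about to run the continuation `κ`. -/
noncomputable def config (P : Prog) (κ : List Prog) (o : Option Bool) (s : Store) : P.machine.Cfg :=
  ⟨some (P.lab κ), o, contents P.width s⟩

theorem step_config (P : Prog) {κ : List Prog} (h : κ ∈ P.labels) (o : Option Bool) (s : Store) :
    P.machine.step (P.config κ o s) =
      some (Turing.TM2.stepAux (P.code κ) o (contents P.width s)) := by
  change some (Turing.TM2.stepAux (P.code (P.lab κ)) o (contents P.width s)) = _
  rw [coe_lab h]

/-- `t` steps of a machine lead from `c` to `d`. -/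
def Steps (M : Turing.FinTM2) (c : M.Cfg) (t : ℕ) (d : M.Cfg) : Prop :=
  (flip bind M.step)^[t] (some c) = some d

theorem Steps.one {M : Turing.FinTM2} {c d : M.Cfg} (h : M.step c = some d) : Steps M c 1 d := h

theorem Steps.trans {M : Turing.FinTM2} {c d e : M.Cfg} {t t' : ℕ} (h : Steps M c t d)
    (h' : Steps M d t' e) : Steps M c (t + t') e := by
  unfold Steps at *
  rw [add_comm, Function.iterate_add_apply, h, h']

/-- Each step of the program semantics is exactly one machine step. The induction needs every
continuation and every internal state, because a pop leaves its symbol behind in that state. -/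
theorem steps_of_exec (P : Prog) {Q : Prog} {s s' : Store} {t : ℕ} (h : Exec Q s t s')
    (hw : Q.width ≤ P.width) (κ : List Prog) (hQ : Q.conts κ ⊆ P.labels) (hκ : κ ∈ P.labels)
    (o : Option Bool) : ∃ o', Steps P.machine (P.config (Q :: κ) o s) t (P.config κ o' s') := by
  induction h generalizing κ o with
  | skip s =>
    refine ⟨o, Steps.one ?_⟩
    rw [step_config P (hQ (self_mem_conts _ _))]
    rfl
  | inc k s =>
    refine ⟨o, Steps.one ?_⟩
    rw [step_config P (hQ (self_mem_conts _ _))]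
    simp only [code, Turing.TM2.stepAux]
    rw [contents_stackOf hw, ← List.replicate_succ, update_contents hw]
    rfl
  | @seq Q R s s' s'' t t' _ _ ih ih' =>
    have h1 : Steps P.machine (P.config (.seq Q R :: κ) o s) 1 (P.config (Q :: R :: κ) o s) := by
      refine Steps.one ?_
      rw [step_config P (hQ (self_mem_conts _ _))]
      rfl
    have hR : R.conts κ ⊆ P.labels := fun x hx => hQ (Or.inr (Or.inr hx))
    obtain ⟨o', h2⟩ := ih (le_trans (le_max_left _ _) hw) (R :: κ)
      (fun x hx => hQ (Or.inr (Or.inl hx))) (hR (self_mem_conts _ _)) o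
    obtain ⟨o'', h3⟩ := ih' (le_trans (le_max_right _ _) hw) κ hR hκ o'
    exact ⟨o'', (h1.trans h2).trans h3⟩
  | @loop_zero k Q s h0 =>
    have hk : k < P.width := le_trans (le_max_left _ _) hw
    refine ⟨none, Steps.one ?_⟩
    rw [step_config P (hQ (self_mem_conts _ _))]
    simp only [code, Turing.TM2.stepAux]
    have e := update_contents hk s 0
    rw [← h0, Store.set_self, h0] at e
    rw [contents_stackOf hk, h0]
    simp only [List.replicate_zero, List.head?_nil, List.tail_nil] at e ⊢
    rw [e]
    rfl
  | @loop_succ k Q s s' s'' v t t' hv _ _ ih ih' =>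
    have hk : k < P.width := le_trans (le_max_left _ _) hw
    have h1 : Steps P.machine (P.config (.loop k Q :: κ) o s) 1
        (P.config (Q :: .loop k Q :: κ) (some true) (s.set k v)) := by
      refine Steps.one ?_
      rw [step_config P (hQ (self_mem_conts _ _))]
      simp only [code, Turing.TM2.stepAux]
      rw [contents_stackOf hk, hv, List.replicate_succ]
      simp only [List.head?_cons, List.tail_cons]
      rw [update_contents hk]
      rfl
    obtain ⟨o', h2⟩ := ih (le_trans (le_max_right _ _) hw) (.loop k Q :: κ)
      (fun x hx => hQ (Or.inr hx)) (hQ (self_mem_conts _ _)) (some true)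
    obtain ⟨o'', h3⟩ := ih' hw κ hQ hκ o'
    exact ⟨o'', (h1.trans h2).trans h3⟩
  | @read_nil Q s h0 =>
    refine ⟨none, Steps.one ?_⟩
    rw [step_config P (hQ (self_mem_conts _ _))]
    simp only [code, Turing.TM2.stepAux]
    have e := update_contents_inp (m := P.width) s []
    have h1 : contents P.width s (.inl false) = [] := h0
    rw [h1]
    simp only [List.head?_nil, List.tail_nil]
    rw [e, ← h0]
    rfl
  | @read_false Q s r h0 =>
    refine ⟨some false, Steps.one ?_⟩
    rw [step_config P (hQ (self_mem_conts _ _))]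
    simp only [code, Turing.TM2.stepAux]
    have e := update_contents_inp (m := P.width) s r
    have h1 : contents P.width s (.inl false) = false :: r := h0
    rw [h1]
    simp only [List.head?_cons, List.tail_cons]
    rw [e]
    rfl
  | @read_true Q s s' s'' r t t' h0 _ _ ih ih' =>
    have h1 : Steps P.machine (P.config (.read Q :: κ) o s) 1
        (P.config (Q :: .read Q :: κ) (some true) { s with inp := r }) := by
      refine Steps.one ?_
      rw [step_config P (hQ (self_mem_conts _ _))]
      simp only [code, Turing.TM2.stepAux]
      have e := update_contents_inp (m := P.width) s r
      have h1 : contents P.width s (.inl false) = true :: r := h0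
      rw [h1]
      simp only [List.head?_cons, List.tail_cons]
      rw [e]
      rfl
    obtain ⟨o', h2⟩ := ih hw (.read Q :: κ)
      (fun x hx => hQ (Or.inr hx)) (hQ (self_mem_conts _ _)) (some true)
    obtain ⟨o'', h3⟩ := ih' hw κ hQ hκ o'
    exact ⟨o'', (h1.trans h2).trans h3⟩
  | emit k s =>
    have hk : k < P.width := hw
    refine ⟨(List.replicate (s.reg k) true).head?, Steps.one ?_⟩
    rw [step_config P (hQ (self_mem_conts _ _))]
    simp only [code, Turing.TM2.stepAux]
    rw [contents_stackOf hk, List.tail_replicate, update_contents hk]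
    have h1 : contents P.width (s.set k (s.reg k - 1)) (.inl true) = s.out := rfl
    have h2 : (List.replicate (s.reg k) true).head?.isSome = decide (0 < s.reg k) := by
      cases s.reg k <;> simp [List.replicate_succ]
    rw [h1, update_contents_out, h2]
    rfl

/-- The machine of `P` with its input and output alphabets. -/
noncomputable def aux (P : Prog) : Turing.TM2ComputableAux Bool Bool where
  tm := P.machine
  inputAlphabet := Equiv.refl _
  outputAlphabet := Equiv.refl _

theorem haltsWithin_of_exec {P : Prog} {u w : List Bool} {t : ℕ}
    (h : Exec P ⟨u, [], fun _ => 0⟩ t ⟨[], w, fun _ => 0⟩) : HaltsWithin P.aux u w (t + 1) := by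
  obtain ⟨o', h1⟩ := steps_of_exec P h le_rfl [] (fun x hx => Or.inr hx) (Or.inl rfl) none
  have h2 : P.machine.step (P.config [] o' ⟨[], w, fun _ => 0⟩) =
      some ⟨none, none, contents P.width ⟨[], w, fun _ => 0⟩⟩ :=
    step_config P (Or.inl rfl) _ _
  have h3 := h1.trans (Steps.one h2)
  have e1 : Turing.initList P.machine u = P.config [P] none ⟨u, [], fun _ => 0⟩ := by
    refine congrArg (Turing.TM2.Cfg.mk _ _) (funext fun x => ?_)
    rcases x with (_ | _) | x <;> rfl
  have e2 : Turing.haltList P.machine w =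
      ⟨none, none, contents P.width ⟨[], w, fun _ => 0⟩⟩ := by
    refine congrArg (Turing.TM2.Cfg.mk _ _) (funext fun x => ?_)
    rcases x with (_ | _) | x <;> rfl
  have hi : u.map P.aux.inputAlphabet.symm = u := List.map_id _
  have ho : w.map P.aux.outputAlphabet.symm = w := List.map_id _
  unfold HaltsWithin
  rw [hi, ho]
  refine ⟨⟨⟨t + 1, ?_⟩, le_rfl⟩⟩
  change (flip bind P.machine.step)^[t + 1] (some (Turing.initList P.machine u)) =
    some (Turing.haltList P.machine w)
  rw [e1, e2]
  exact h3

end Prog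

/-! ### Running programs within a time bound -/

/-- `P` leads from `s` to `s'` in at most `T` steps. -/
def Runs (P : Prog) (s : Store) (T : ℕ) (s' : Store) : Prop := ∃ t ≤ T, Exec P s t s'

theorem Runs.mono {P : Prog} {s s' : Store} {T T' : ℕ} (h : Runs P s T s') (hT : T ≤ T') :
    Runs P s T' s' :=
  let ⟨t, ht, e⟩ := h
  ⟨t, ht.trans hT, e⟩

theorem Runs.cast {P : Prog} {s s' s'' : Store} {T T' : ℕ} (h : Runs P s T s') (hs : s' = s'')
    (hT : T ≤ T') : Runs P s T' s'' := hs ▸ h.mono hT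

theorem Runs.seq {P Q : Prog} {s s' s'' : Store} {T T' : ℕ} (h : Runs P s T s')
    (h' : Runs Q s' T' s'') : Runs (.seq P Q) s (1 + T + T') s'' :=
  let ⟨_, ht, e⟩ := h
  let ⟨_, ht', e'⟩ := h'
  ⟨_, by gcongr, e.seq e'⟩

theorem Runs.skip (s : Store) : Runs .skip s 1 s := ⟨1, le_rfl, .skip s⟩

theorem Runs.inc (k : ℕ) (s : Store) : Runs (.inc k) s 1 (s.set k (s.reg k + 1)) :=
  ⟨1, le_rfl, .inc k s⟩

theorem Runs.loop_zero {k : ℕ} {P : Prog} {s : Store} (h : s.reg k = 0) :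
    Runs (.loop k P) s 1 s := ⟨1, le_rfl, .loop_zero h⟩

theorem Runs.loop_succ {k v : ℕ} {P : Prog} {s s' s'' : Store} {T T' : ℕ} (hv : s.reg k = v + 1)
    (h : Runs P (s.set k v) T s') (h' : Runs (.loop k P) s' T' s'') :
    Runs (.loop k P) s (1 + T + T') s'' :=
  let ⟨_, ht, e⟩ := h
  let ⟨_, ht', e'⟩ := h'
  ⟨_, by gcongr, .loop_succ hv e e'⟩

/-- A loop whose store after `i` rounds is `σ i`. -/
theorem Runs.loop {k : ℕ} {P : Prog} {T : ℕ} (v : ℕ) (σ : ℕ → Store)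
    (hσ : ∀ i ≤ v, (σ i).reg k = v - i)
    (h : ∀ i < v, Runs P ((σ i).set k (v - i - 1)) T (σ (i + 1))) :
    Runs (.loop k P) (σ 0) (v * (T + 1) + 1) (σ v) := by
  -- Induction on the number `j` of remaining rounds, since `Runs.loop_succ` peels off the first
  -- round.
  have key : ∀ j ≤ v, Runs (.loop k P) (σ (v - j)) (j * (T + 1) + 1) (σ v) := by
    intro j
    induction j with
    | zero =>
      intro _
      refine (Runs.loop_zero ?_).mono (by simp)
      simpa using hσ v le_rfl
    | succ j ih =>
      intro hj
      have h1 := hσ (v - (j + 1)) (by omega)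
      have h2 := h (v - (j + 1)) (by omega)
      have e1 : v - (v - (j + 1)) = j + 1 := by omega
      have e2 : v - (j + 1) + 1 = v - j := by omega
      rw [e1] at h1
      rw [e1, e2, Nat.add_sub_cancel] at h2
      refine (Runs.loop_succ h1 h2 (ih (by omega))).mono (le_of_eq ?_)
      ring
  simpa using key v le_rfl

/-- One step raises a counter by at most one. Computed values are therefore bounded by running
times, so a function in `PB` is polynomially bounded without a separate argument. -/
theorem Exec.reg_le {P : Prog} {s s' : Store} {t : ℕ} (h : Exec P s t s') (j : ℕ) :
    s'.reg j ≤ s.reg j + t := by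
  induction h with
  | skip s => omega
  | inc k s =>
    rw [Store.set_reg_apply]; split_ifs with h
    · subst h; omega
    · omega
  | seq _ _ ih ih' => omega
  | loop_zero _ => omega
  | @loop_succ k P s s' s'' v t t' hv _ _ ih ih' =>
    rw [Store.set_reg_apply] at ih
    split_ifs at ih with h
    · subst h; omega
    · omega
  | read_nil _ => omega
  | read_false _ => exact Nat.le_add_right _ _
  | read_true _ _ _ ih ih' => dsimp only at ih; omega
  | emit k s =>
    change (s.set k (s.reg k - 1)).reg j ≤ _
    rw [Store.set_reg_apply]; split_ifs with h
    · subst h; omega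
    · omega

/-! ### Clearing, moving and copying counters. -/

namespace Prog

/-- Reset a counter. -/
def clear (k : ℕ) : Prog := .loop k .skip

/-- Empty counter `j` into counter `k`. -/
def move (j k : ℕ) : Prog := .loop j (.inc k)

/-- Add counter `j` to counter `k`, using the empty counter `m`. -/
def copy (j k m : ℕ) : Prog := .seq (.loop j (.seq (.inc k) (.inc m))) (move m j)

theorem runs_clear (k : ℕ) (s : Store) : Runs (clear k) s (2 * s.reg k + 1) (s.set k 0) := by
  have := Runs.loop (k := k) (P := .skip) (T := 1) (s.reg k) (fun i => s.set k (s.reg k - i))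
    (fun i _ => by simp) (fun i hi => by
      simpa [Nat.sub_sub] using Runs.skip (s.set k (s.reg k - i - 1)))
  simp only [Nat.sub_zero, Store.set_self, Nat.sub_self] at this
  exact this.mono (by omega)

theorem runs_move {j k : ℕ} (hjk : j ≠ k) (s : Store) :
    Runs (move j k) s (2 * s.reg j + 1) ((s.set j 0).set k (s.reg k + s.reg j)) := by
  have := Runs.loop (k := j) (P := .inc k) (T := 1) (s.reg j)
    (fun i => (s.set j (s.reg j - i)).set k (s.reg k + i))
    (fun i _ => by rw [Store.set_reg_ne _ _ hjk]; simp) (fun i hi => by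
      have := Runs.inc k (((s.set j (s.reg j - i)).set k (s.reg k + i)).set j (s.reg j - i - 1))
      refine this.cast (Store.ext_reg rfl rfl fun x => ?_) le_rfl
      simp only [Store.set_reg_apply]
      split_ifs <;> omega)
  have e : (s.set j (s.reg j - 0)).set k (s.reg k + 0) = s := by simp
  rw [e, Nat.sub_self] at this
  exact this.mono (by omega)

theorem runs_copy {j k m : ℕ} (hjk : j ≠ k) (hjm : j ≠ m) (hkm : k ≠ m) (s : Store)
    (hm : s.reg m = 0) :
    Runs (copy j k m) s (6 * s.reg j + 3) (s.set k (s.reg k + s.reg j)) := by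
  have h1 := Runs.loop (k := j) (P := .seq (.inc k) (.inc m)) (T := 3) (s.reg j)
    (fun i => ((s.set j (s.reg j - i)).set k (s.reg k + i)).set m i)
    (fun i _ => by rw [Store.set_reg_ne _ _ hjm, Store.set_reg_ne _ _ hjk]; simp) (fun i hi => by
      have := (Runs.inc k ((((s.set j (s.reg j - i)).set k (s.reg k + i)).set m i).set j
        (s.reg j - i - 1))).seq (Runs.inc m _)
      refine this.cast (Store.ext_reg rfl rfl fun x => ?_) le_rfl
      simp only [Store.set_reg_apply]
      split_ifs <;> omega)
  have e : ((s.set j (s.reg j - 0)).set k (s.reg k + 0)).set m 0 = s := by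
    refine Store.ext_reg rfl rfl fun x => ?_
    simp only [Store.set_reg_apply]
    split_ifs with h1 h2 h3 <;> simp_all
  rw [e, Nat.sub_self] at h1
  have h2 := h1.seq (runs_move hjm.symm _)
  refine h2.cast (Store.ext_reg rfl rfl fun x => ?_) ?_
  · simp only [Store.set_reg_apply]
    split_ifs <;> simp_all
  · simp only [Store.set_reg_apply, if_true]; omega

end Prog

/-! ### Polynomially bounded functions -/

/-- A domain whose elements are described by finitely many natural numbers. -/
class Ctx (α : Type) where
  Var : Type
  fintypeVar : Fintype Var
  val : α → Var → ℕ

attribute [reducible, instance] Ctx.fintypeVar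

instance : Ctx ℕ := ⟨Unit, inferInstance, fun a _ => a⟩

instance {α β : Type} [Ctx α] [Ctx β] : Ctx (α × β) :=
  ⟨Ctx.Var α ⊕ Ctx.Var β, inferInstance, fun p => Sum.elim (Ctx.val p.1) (Ctx.val p.2)⟩

/-- The size of an element: the sum of its coordinates. -/
def csize {α : Type} [Ctx α] (a : α) : ℕ := ∑ i, Ctx.val a i

@[simp] theorem csize_nat (n : ℕ) : csize n = n := by
  change ∑ _ : Unit, n = n
  simp

@[simp] theorem csize_pair {α β : Type} [Ctx α] [Ctx β] (a : α) (b : β) :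
    csize (a, b) = csize a + csize b := by
  change ∑ i : Ctx.Var α ⊕ Ctx.Var β, Sum.elim (Ctx.val a) (Ctx.val b) i = _
  rw [Fintype.sum_sum_type]; rfl

theorem val_le_csize {α : Type} [Ctx α] (a : α) (i : Ctx.Var α) : Ctx.val a i ≤ csize a :=
  Finset.single_le_sum (f := Ctx.val a) (fun _ _ => Nat.zero_le _) (Finset.mem_univ i)

theorem eval_mono (q : Polynomial ℕ) {x y : ℕ} (h : x ≤ y) : q.eval x ≤ q.eval y := by
  rw [Polynomial.eval_eq_sum_range, Polynomial.eval_eq_sum_range]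
  gcongr

/-- `f` is bounded by a polynomial in the size of its argument. -/
def PolyBounded {α : Type} [Ctx α] (f : α → ℕ) : Prop :=
  ∃ q : Polynomial ℕ, ∀ a, f a ≤ q.eval (csize a)

namespace PolyBounded

variable {α β : Type} [Ctx α] [Ctx β] {f g : α → ℕ}

theorem mono (h : PolyBounded g) (hfg : ∀ a, f a ≤ g a) : PolyBounded f :=
  let ⟨q, hq⟩ := h
  ⟨q, fun a => (hfg a).trans (hq a)⟩

theorem const (c : ℕ) : PolyBounded fun _ : α => c := ⟨.C c, fun a => by simp⟩

theorem size : PolyBounded (csize : α → ℕ) := ⟨.X, fun a => by simp⟩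

theorem add (hf : PolyBounded f) (hg : PolyBounded g) : PolyBounded fun a => f a + g a :=
  let ⟨p, hp⟩ := hf
  let ⟨q, hq⟩ := hg
  ⟨p + q, fun a => by simpa using add_le_add (hp a) (hq a)⟩

theorem mul (hf : PolyBounded f) (hg : PolyBounded g) : PolyBounded fun a => f a * g a :=
  let ⟨p, hp⟩ := hf
  let ⟨q, hq⟩ := hg
  ⟨p * q, fun a => by simpa using Nat.mul_le_mul (hp a) (hq a)⟩

theorem eval (q : Polynomial ℕ) (hf : PolyBounded f) : PolyBounded fun a => q.eval (f a) :=
  let ⟨p, hp⟩ := hf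
  ⟨q.comp p, fun a => by simpa using eval_mono q (hp a)⟩

theorem comp {F : β → ℕ} (hF : PolyBounded F) {φ : α → β}
    (hφ : PolyBounded fun a => csize (φ a)) : PolyBounded fun a => F (φ a) :=
  let ⟨q, hq⟩ := hF
  (hφ.eval q).mono fun a => hq (φ a)

end PolyBounded

/-! ### Functions computed in polynomial time -/

/-- `f` is computed by programs in polynomially many steps: the arguments are read from given
counters below `m`, the value is left in counter `m`, and the other counters keep their values. -/
def PB {α : Type} [Ctx α] (f : α → ℕ) : Prop :=
  ∀ (arg : Ctx.Var α → ℕ) (m : ℕ), (∀ i, arg i < m) →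
    ∃ (P : Prog) (T : α → ℕ), PolyBounded T ∧
      ∀ (a : α) (s : Store), (∀ i, s.reg (arg i) = Ctx.val a i) → (∀ j, m ≤ j → s.reg j = 0) →
        Runs P s (T a) (s.set m (f a))

/-- Every coordinate of `φ a` is a coordinate of `a`. -/
def Reindex {α β : Type} [Ctx α] [Ctx β] (φ : α → β) : Prop :=
  ∀ i : Ctx.Var β, ∃ j : Ctx.Var α, ∀ a, Ctx.val (φ a) i = Ctx.val a j

namespace Reindex

variable {α β γ : Type} [Ctx α] [Ctx β] [Ctx γ]

theorem fst : Reindex (Prod.fst : α × β → α) := fun i => ⟨Sum.inl i, fun _ => rfl⟩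

theorem snd : Reindex (Prod.snd : α × β → β) := fun i => ⟨Sum.inr i, fun _ => rfl⟩

theorem comp {φ : α → β} {ψ : β → γ} (hψ : Reindex ψ) (hφ : Reindex φ) :
    Reindex fun a => ψ (φ a) := fun i =>
  let ⟨j, hj⟩ := hψ i
  let ⟨k, hk⟩ := hφ j
  ⟨k, fun a => (hj _).trans (hk a)⟩

theorem pair {φ : α → β} {ψ : α → γ} (hφ : Reindex φ) (hψ : Reindex ψ) :
    Reindex fun a => (φ a, ψ a) := fun i =>
  match i with
  | .inl i => hφ i
  | .inr i => hψ i

end Reindex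

/-! ### Composition and bounded recursion in polynomial time. -/

namespace PB

variable {α β : Type} [Ctx α] [Ctx β]

theorem polyBounded {f : α → ℕ} (hf : PB f) : PolyBounded f := by
  let e := Fintype.equivFin (Ctx.Var α)
  obtain ⟨P, T, hT, h⟩ := hf (fun i => e i) (Fintype.card (Ctx.Var α)) (fun i => (e i).2)
  refine hT.mono fun a => ?_
  obtain ⟨t, ht, h⟩ := h a ⟨[], [], fun j =>
    if h : j < Fintype.card (Ctx.Var α) then Ctx.val a (e.symm ⟨j, h⟩) else 0⟩
    (fun i => by simp) (fun j hj => by simp [Nat.not_lt.2 hj])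
  simpa using (h.reg_le (Fintype.card (Ctx.Var α))).trans (by simpa using ht)

/-- The same program works, reading its arguments from other counters. This is why `PB` quantifies
over all placements `arg` of the arguments. -/
theorem reindex {f : β → ℕ} (hf : PB f) {φ : α → β} (hφ : Reindex φ) :
    PB fun a => f (φ a) := by
  choose j hj using hφ
  intro arg m hm
  obtain ⟨P, T, hT, h⟩ := hf (fun i => arg (j i)) m (fun i => hm _)
  refine ⟨P, fun a => T (φ a), hT.comp ?_, fun a s hs h0 => h (φ a) s (fun i => ?_) h0⟩
  · refine (PolyBounded.mul (PolyBounded.const (Fintype.card (Ctx.Var β)))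
      PolyBounded.size).mono fun a => ?_
    unfold csize
    rw [← smul_eq_mul]
    refine Finset.sum_le_card_nsmul _ _ _ fun i _ => ?_
    rw [hj]; exact val_le_csize a _
  · rw [hs, hj]

theorem zero : PB fun _ : α => 0 := by
  intro arg m hm
  refine ⟨.skip, fun _ => 1, .const 1, fun a s _ h0 => ?_⟩
  refine (Runs.skip s).cast ?_ le_rfl
  conv_lhs => rw [← Store.set_self s m, h0 m le_rfl]

theorem succ {f : α → ℕ} (hf : PB f) : PB fun a => f a + 1 := by
  intro arg m hm
  obtain ⟨P, T, hT, h⟩ := hf arg m hm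
  refine ⟨.seq P (.inc m), fun a => 1 + T a + 1, ((PolyBounded.const 1).add hT).add (.const 1),
    fun a s hs h0 => ?_⟩
  simpa using (h a s hs h0).seq (Runs.inc m _)

theorem const (c : ℕ) : PB fun _ : α => c := by
  induction c with
  | zero => exact zero
  | succ c ih => exact ih.succ

theorem var (i : Ctx.Var α) : PB fun a : α => Ctx.val a i := by
  intro arg m hm
  refine ⟨Prog.copy (arg i) m (m + 1), fun a => 6 * Ctx.val a i + 3, ?_, fun a s hs h0 => ?_⟩
  · exact (((PolyBounded.const 6).mul PolyBounded.size).add (.const 3)).mono fun a => by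
      have := val_le_csize a i
      gcongr
  · have := hm i
    have h := Prog.runs_copy (j := arg i) (k := m) (m := m + 1) (by omega) (by omega) (by omega) s
      (h0 _ (by omega))
    simpa [h0 m le_rfl, hs] using h

theorem id : PB (fun a : ℕ => a) := var (α := ℕ) ()

/-- Counter `m` first holds `f a` and serves as an extra argument; the value of `g` appears in `m +
1` and is finally moved to `m`. -/
theorem letIn {f : α → ℕ} {g : α × ℕ → ℕ} (hf : PB f) (hg : PB g) : PB fun a => g (a, f a) := by
  intro arg m hm
  obtain ⟨P, T, hT, h⟩ := hf arg m hm
  obtain ⟨Q, T', hT', h'⟩ := hg (Sum.elim arg fun _ => m) (m + 1) (by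
    rintro (i | i)
    · exact (hm i).trans (Nat.lt_succ_self m)
    · exact Nat.lt_succ_self m)
  have hpair : PolyBounded fun a => csize (a, f a) := by
    simpa using PolyBounded.size.add hf.polyBounded
  have hgf : PolyBounded fun a => g (a, f a) := hg.polyBounded.comp hpair
  refine ⟨.seq P (.seq Q (.seq (Prog.clear m) (Prog.move (m + 1) m))),
    fun a => 1 + T a + (1 + T' (a, f a) + (1 + (2 * f a + 1) + (2 * g (a, f a) + 1))),
    ?_, fun a s hs h0 => ?_⟩
  · exact ((PolyBounded.const 1).add hT).add (((PolyBounded.const 1).add (hT'.comp hpair)).add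
      (((PolyBounded.const 1).add (((PolyBounded.const 2).mul hf.polyBounded).add (.const 1))).add
        (((PolyBounded.const 2).mul hgf).add (.const 1))))
  · have h1 := h a s hs h0
    have h2 := h' (a, f a) (s.set m (f a)) (by
      rintro (i | i)
      · rw [Sum.elim_inl, Store.set_reg_ne _ _ (hm i).ne]; exact hs i
      · simp; rfl) (fun j hj => by
        rw [Store.set_reg_ne _ _ (by omega)]; exact h0 j (by omega))
    have h3 := Prog.runs_clear m ((s.set m (f a)).set (m + 1) (g (a, f a)))
    have h4 := Prog.runs_move (j := m + 1) (k := m) (by omega)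
      (((s.set m (f a)).set (m + 1) (g (a, f a))).set m 0)
    have h5 := h1.seq (h2.seq (h3.seq h4))
    refine h5.cast (Store.ext_reg rfl rfl fun x => ?_) (le_of_eq ?_)
    · simp only [Store.set_reg_apply]
      have := h0 (m + 1) (by omega)
      split_ifs <;> simp_all
    · simp [Store.set_reg_apply]

theorem comp {F : ℕ → ℕ} (hF : PB F) {f : α → ℕ} (hf : PB f) : PB fun a => F (f a) :=
  hf.letIn (g := fun p => F p.2) (hF.reindex Reindex.snd)

theorem comp₂ {F : ℕ × ℕ → ℕ} (hF : PB F) {f g : α → ℕ} (hf : PB f) (hg : PB g) :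
    PB fun a => F (f a, g a) :=
  hf.letIn (g := fun p => F (p.2, g p.1)) <|
    (hg.reindex Reindex.fst).letIn (g := fun p : (α × ℕ) × ℕ => F (p.1.2, p.2)) <|
      hF.reindex ((Reindex.snd.comp Reindex.fst).pair Reindex.snd)

/-- Iterating a polynomial-time step may produce exponential growth, so a polynomial bound `B` on
the intermediate values is required; it also bounds the cost of every round. Counter `m` holds the
remaining rounds, `m + 1` the current value, `m + 2` the index, and `m + 3` the new value. -/
theorem natRec {n g : α → ℕ} {h : (α × ℕ) × ℕ → ℕ} (hn : PB n) (hg : PB g) (hh : PB h)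
    {F : α → ℕ → ℕ} (F0 : ∀ a, F a 0 = g a) (FS : ∀ a i, F a (i + 1) = h ((a, i), F a i))
    {B : α → ℕ} (hB : PolyBounded B) (hF : ∀ a, ∀ i ≤ n a, F a i ≤ B a) :
    PB fun a => F a (n a) := by
  intro arg m hm
  obtain ⟨P, T, hT, hP⟩ := hn arg m hm
  obtain ⟨Q, T', hT', hQ⟩ := hg arg (m + 1) (fun i => (hm i).trans (Nat.lt_succ_self m))
  obtain ⟨R, T'', ⟨q, hq⟩, hR⟩ := hh
    (Sum.elim (Sum.elim arg fun _ => m + 2) fun _ => m + 1) (m + 3) (by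
    rintro ((i | i) | i)
    · exact (hm i).trans (by omega)
    · exact (by omega : m + 2 < m + 3)
    · exact (by omega : m + 1 < m + 3))
  let Tb : α → ℕ := fun a => q.eval (csize a + n a + B a) + (4 * B a + 6)
  have hTb : PolyBounded Tb := (((PolyBounded.size.add hn.polyBounded).add hB).eval q).add
    (((PolyBounded.const 4).mul hB).add (.const 6))
  refine ⟨.seq P (.seq Q (.seq (.loop m (.seq R (.seq (Prog.clear (m + 1))
      (.seq (Prog.move (m + 3) (m + 1)) (.inc (m + 2))))))
      (.seq (Prog.clear (m + 2)) (Prog.move (m + 1) m)))),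
    fun a => 1 + T a + (1 + T' a + (1 + (n a * (Tb a + 1) + 1) +
      (1 + (2 * n a + 1) + (2 * B a + 1)))), ?_, fun a s hs h0 => ?_⟩
  · exact ((PolyBounded.const 1).add hT).add (((PolyBounded.const 1).add hT').add
      (((PolyBounded.const 1).add ((hn.polyBounded.mul (hTb.add (.const 1))).add (.const 1))).add
        (((PolyBounded.const 1).add (((PolyBounded.const 2).mul hn.polyBounded).add
          (.const 1))).add (((PolyBounded.const 2).mul hB).add (.const 1)))))
  · have h1 := hP a s hs h0
    have h2 := hQ a (s.set m (n a)) (fun i => by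
      rw [Store.set_reg_ne _ _ (hm i).ne]; exact hs i) (fun j hj => by
        rw [Store.set_reg_ne _ _ (by omega)]; exact h0 j (by omega))
    let σ : ℕ → Store := fun i => ((s.set m (n a - i)).set (m + 1) (F a i)).set (m + 2) i
    have h3 : Runs _ (σ 0) _ (σ (n a)) := Runs.loop (k := m)
      (P := .seq R (.seq (Prog.clear (m + 1)) (.seq (Prog.move (m + 3) (m + 1)) (.inc (m + 2)))))
      (T := Tb a) (n a) σ (fun i _ => by simp [σ, Store.set_reg_apply]) (fun i hi => by
        have r1 := hR ((a, i), F a i) ((σ i).set m (n a - i - 1)) (by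
          rintro ((x | x) | x)
          · have := hm x
            simp only [Sum.elim_inl]
            rw [Store.set_reg_ne _ _ (by omega), Store.set_reg_ne _ _ (by omega),
              Store.set_reg_ne _ _ (by omega), Store.set_reg_ne _ _ (by omega)]
            exact hs x
          · simp [σ, Store.set_reg_apply]; rfl
          · simp [σ, Store.set_reg_apply]; rfl) (fun j hj => by
          simp only [σ]
          rw [Store.set_reg_ne _ _ (by omega), Store.set_reg_ne _ _ (by omega),
              Store.set_reg_ne _ _ (by omega), Store.set_reg_ne _ _ (by omega)]
          exact h0 j (by omega))
        have r2 := r1.seq ((Prog.runs_clear (m + 1) _).seq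
          ((Prog.runs_move (j := m + 3) (k := m + 1) (by omega) _).seq (Runs.inc (m + 2) _)))
        refine r2.cast (Store.ext_reg rfl rfl fun x => ?_) ?_
        · simp only [Store.set_reg_apply, σ, FS]
          have := h0 (m + 3) (by omega)
          split_ifs <;> first | omega | simp_all
        · have b1 := hF a i hi.le
          have b2 := hF a (i + 1) hi
          rw [FS] at b2
          have b3 := (hq ((a, i), F a i)).trans (eval_mono q (y := csize a + n a + B a) (by
            simp only [csize_pair, csize_nat]; omega))
          simp only [Store.set_reg_apply, σ, Tb]
          simp
          omega)
    have e : σ 0 = (s.set m (n a)).set (m + 1) (g a) := by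
      refine Store.ext_reg rfl rfl fun x => ?_
      have := h0 (m + 2) (by omega)
      simp only [Store.set_reg_apply, σ, F0]
      split_ifs <;> simp_all
    rw [e] at h3
    have h4 := h1.seq (h2.seq (h3.seq ((Prog.runs_clear (m + 2) _).seq
      (Prog.runs_move (j := m + 1) (k := m) (by omega) _))))
    refine h4.cast (Store.ext_reg rfl rfl fun x => ?_) ?_
    · have := h0 (m + 1) (by omega)
      have := h0 (m + 2) (by omega)
      simp only [Store.set_reg_apply, σ]
      split_ifs <;> first | omega | simp_all
    · have b1 := hF a (n a) le_rfl
      simp only [Store.set_reg_apply, σ]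
      simp
      omega

end PB

namespace PB

variable {α β : Type} [Ctx α] [Ctx β]

/-! ### Closure properties: arithmetic -/

theorem of_reindex {φ : α → ℕ} (h : Reindex φ) : PB φ := PB.id.reindex h

theorem fst {f : α → ℕ} (hf : PB f) : PB fun p : α × β => f p.1 := hf.reindex Reindex.fst

theorem last : PB fun p : α × ℕ => p.2 := of_reindex Reindex.snd

theorem add {f g : α → ℕ} (hf : PB f) (hg : PB g) : PB fun a => f a + g a := by
  have : PB fun p : ℕ × ℕ => p.1 + p.2 :=
    natRec (n := Prod.snd) (g := Prod.fst) (h := fun q => q.2 + 1) (F := fun p i => p.1 + i)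
      (B := fun p => p.1 + p.2) last PB.id.fst last.succ
      (fun _ => rfl) (fun _ _ => rfl) (PolyBounded.size.mono fun p => by
        obtain ⟨x, y⟩ := p; simp) (fun p i hi => by omega)
  exact comp₂ this hf hg

theorem pred {f : α → ℕ} (hf : PB f) : PB fun a => f a - 1 := by
  have : PB fun x : ℕ => x - 1 :=
    natRec (n := fun x => x) (g := fun _ => 0) (h := fun q => q.1.2) (F := fun _ i => i - 1)
      (B := fun x => x) PB.id zero last.fst (fun _ => rfl) (fun _ _ => rfl)
      (PolyBounded.size.mono fun p => by simp) (fun p i hi => by omega)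
  exact this.comp hf

theorem sub {f g : α → ℕ} (hf : PB f) (hg : PB g) : PB fun a => f a - g a := by
  have : PB fun p : ℕ × ℕ => p.1 - p.2 :=
    natRec (n := Prod.snd) (g := Prod.fst) (h := fun q => q.2 - 1) (F := fun p i => p.1 - i)
      (B := fun p => p.1) last PB.id.fst last.pred
      (fun _ => rfl) (fun _ _ => rfl) (PolyBounded.size.mono fun p => by
        obtain ⟨x, y⟩ := p; simp) (fun p i hi => by omega)
  exact comp₂ this hf hg

theorem mul {f g : α → ℕ} (hf : PB f) (hg : PB g) : PB fun a => f a * g a := by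
  have : PB fun p : ℕ × ℕ => p.1 * p.2 :=
    natRec (n := Prod.snd) (g := fun _ => 0) (h := fun q => q.2 + q.1.1.1)
      (F := fun p i => p.1 * i) (B := fun p => csize p * csize p) last zero
      (last.add PB.id.fst.fst.fst) (fun _ => rfl) (fun _ _ => rfl)
      (PolyBounded.size.mul PolyBounded.size) (fun p i hi => by
        obtain ⟨x, y⟩ := p
        simp only [csize_pair, csize_nat] at *
        exact Nat.mul_le_mul (by omega) (by omega))
  exact comp₂ this hf hg

end PB

/-- A bound, uniform for `i ≤ n a`, for the values of a function computed in polynomial time. -/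
theorem PolyBounded.exists_uniform {α : Type} [Ctx α] {f : α × ℕ → ℕ} (hf : PolyBounded f)
    {n : α → ℕ} (hn : PolyBounded n) :
    ∃ B : α → ℕ, PolyBounded B ∧ ∀ a, ∀ i ≤ n a, f (a, i) ≤ B a := by
  obtain ⟨q, hq⟩ := hf
  exact ⟨fun a => q.eval (csize a + n a), (PolyBounded.size.add hn).eval q, fun a i hi =>
    (hq _).trans (eval_mono q (by simpa using hi))⟩

theorem PB.sum {α : Type} [Ctx α] {n : α → ℕ} {f : α → ℕ → ℕ} (hn : PB n)
    (hf : PB fun p : α × ℕ => f p.1 p.2) : PB fun a => ∑ i ∈ Finset.range (n a), f a i := by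
  obtain ⟨B, hB, h⟩ := hf.polyBounded.exists_uniform hn.polyBounded
  refine natRec (F := fun a k => ∑ i ∈ Finset.range k, f a i) (B := fun a => n a * B a)
    (g := fun _ => 0) (h := fun q => q.2 + f q.1.1 q.1.2) hn zero (last.add hf.fst)
    (fun _ => rfl) (fun a i => Finset.sum_range_succ _ _) (hn.polyBounded.mul hB) fun a k hk => ?_
  calc ∑ i ∈ Finset.range k, f a i ≤ ∑ i ∈ Finset.range k, B a :=
        Finset.sum_le_sum fun i hi => h a i ((Finset.mem_range.1 hi).le.trans hk)
    _ ≤ n a * B a := by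
        rw [Finset.sum_const, Finset.card_range, smul_eq_mul]
        exact Nat.mul_le_mul_right _ hk

theorem PB.sum_const {α : Type} [Ctx α] (k : ℕ) {f : ℕ → α → ℕ} (hf : ∀ j, PB (f j)) :
    PB fun a => ∑ j ∈ Finset.range k, f j a := by
  induction k with
  | zero => exact zero
  | succ k ih => simpa only [Finset.sum_range_succ] using ih.add (hf k)

theorem PB.pow {α : Type} [Ctx α] {f : α → ℕ} (hf : PB f) (k : ℕ) : PB fun a => f a ^ k := by
  induction k with
  | zero => exact const 1
  | succ k ih => simpa only [pow_succ] using ih.mul hf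

/-! ### Closure properties: predicates -/

open Classical in
/-- A predicate that is decided in polynomial time. -/
def PBP {α : Type} [Ctx α] (p : α → Prop) : Prop := PB fun a => if p a then 1 else 0

namespace PBP

variable {α β : Type} [Ctx α] [Ctx β] {p q : α → Prop}

theorem reindex {p : β → Prop} (hp : PBP p) {φ : α → β} (hφ : Reindex φ) : PBP fun a => p (φ a) :=
  PB.reindex hp hφ

theorem congr (hp : PBP p) (h : ∀ a, p a ↔ q a) : PBP q := by
  have : p = q := funext fun a => propext (h a)
  rwa [← this]

theorem indicator (hp : PBP p) [DecidablePred p] : PB fun a => if p a then 1 else 0 := by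
  convert (show PB _ from hp)

theorem ite (hp : PBP p) [DecidablePred p] {f g : α → ℕ} (hf : PB f) (hg : PB g) :
    PB fun a => if p a then f a else g a := by
  have := (hp.indicator.mul hf).add (((PB.const 1).sub hp.indicator).mul hg)
  refine (congrArg PB (funext fun a => ?_)).mp this
  split_ifs <;> simp

theorem not (hp : PBP p) : PBP fun a => ¬ p a := by
  classical
  have := (PB.const 1).sub hp.indicator
  refine (congrArg PB (funext fun a => ?_)).mp this
  by_cases h : p a <;> simp [h]

theorem and (hp : PBP p) (hq : PBP q) : PBP fun a => p a ∧ q a := by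
  classical
  have := hp.indicator.mul hq.indicator
  refine (congrArg PB (funext fun a => ?_)).mp this
  by_cases h : p a <;> simp [h]

theorem or (hp : PBP p) (hq : PBP q) : PBP fun a => p a ∨ q a :=
  (hp.not.and hq.not).not.congr fun a => by tauto

theorem imp (hp : PBP p) (hq : PBP q) : PBP fun a => p a → q a :=
  (hp.not.or hq).congr fun a => by tauto

theorem le {f g : α → ℕ} (hf : PB f) (hg : PB g) : PBP fun a => f a ≤ g a := by
  have := (PB.const 1).sub (hf.sub hg)
  refine (congrArg PB (funext fun a => ?_)).mp this
  split_ifs <;> omega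

theorem lt {f g : α → ℕ} (hf : PB f) (hg : PB g) : PBP fun a => f a < g a := le hf.succ hg

theorem eq {f g : α → ℕ} (hf : PB f) (hg : PB g) : PBP fun a => f a = g a :=
  ((le hf hg).and (le hg hf)).congr fun a => by omega

theorem ne {f g : α → ℕ} (hf : PB f) (hg : PB g) : PBP fun a => f a ≠ g a := (eq hf hg).not

theorem exists_lt {n : α → ℕ} {r : α → ℕ → Prop} (hn : PB n)
    (hr : PBP fun x : α × ℕ => r x.1 x.2) : PBP fun a => ∃ i < n a, r a i := by
  classical
  refine (lt (PB.const 0) (PB.sum (f := fun a i => if r a i then 1 else 0) hn hr.indicator)).congr fun a => ?_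
  rw [Finset.sum_pos_iff]
  simp only [Finset.mem_range]
  refine exists_congr fun i => and_congr_right fun _ => ?_
  by_cases h : r a i <;> simp [h]

theorem forall_lt {n : α → ℕ} {r : α → ℕ → Prop} (hn : PB n)
    (hr : PBP fun x : α × ℕ => r x.1 x.2) : PBP fun a => ∀ i < n a, r a i :=
  (exists_lt (r := fun a i => ¬ r a i) hn hr.not).not.congr fun a => by push Not; rfl

theorem card_filter {n : α → ℕ} {r : α → ℕ → Prop} [∀ a, DecidablePred (r a)] (hn : PB n)
    (hr : PBP fun x : α × ℕ => r x.1 x.2) :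
    PB fun a => ((Finset.range (n a)).filter (r a)).card := by
  simp only [Finset.card_filter]
  have : DecidablePred fun x : α × ℕ => r x.1 x.2 := fun x => inferInstance
  refine PB.sum (f := fun a i => if r a i then 1 else 0) hn ?_
  convert hr.indicator

end PBP

namespace PB

variable {α : Type} [Ctx α]

/-- The quotient counts the positive multiples of `g a` up to `f a`; the divisor `0` is treated
apart. -/
theorem div {f g : α → ℕ} (hf : PB f) (hg : PB g) : PB fun a => f a / g a := by
  have h := (PBP.eq hg (.const 0)).ite zero (PBP.card_filter (r := fun a i => (i + 1) * g a ≤ f a)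
    hf (PBP.le (last.succ.mul hg.fst) hf.fst))
  refine (congrArg PB (funext fun a => ?_)).mp h
  split_ifs with h0
  · simp [h0]
  · have hpos : 0 < g a := Nat.pos_of_ne_zero h0
    have : (Finset.range (f a)).filter (fun i => (i + 1) * g a ≤ f a) =
        Finset.range (f a / g a) := by
      ext i
      simp only [Finset.mem_filter, Finset.mem_range]
      rw [← Nat.le_div_iff_mul_le hpos, Nat.succ_le_iff]
      exact ⟨fun h => h.2, fun h => ⟨h.trans_le (Nat.div_le_self _ _), h⟩⟩
    rw [this, Finset.card_range]

theorem mod {f g : α → ℕ} (hf : PB f) (hg : PB g) : PB fun a => f a % g a := by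
  have h := hf.sub (hg.mul (hf.div hg))
  refine (congrArg PB (funext fun a => ?_)).mp h
  have := Nat.mod_add_div (f a) (g a)
  omega

theorem parity {f : α → ℕ} (hf : PB f) : PB fun a => f a % 2 := hf.mod (const 2)

theorem half {f : α → ℕ} (hf : PB f) : PB fun a => f a / 2 := hf.div (const 2)

/-- Repeated halving avoids ever storing `2 ^ g a`, which need not be polynomially bounded. -/
theorem shiftRight {f g : α → ℕ} (hf : PB f) (hg : PB g) : PB fun a => f a / 2 ^ g a := by
  refine natRec (F := fun a k => f a / 2 ^ k) (g := f) (h := fun q => q.2 / 2) hg hf last.half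
    (fun a => by simp) (fun a i => by rw [pow_succ, Nat.div_div_eq_div_mul]) hf.polyBounded
    fun a i _ => Nat.div_le_self _ _

end PB

/-- The least number below `n` with the property `r`, and `n` if there is none. -/
noncomputable def leastBelow (n : ℕ) (r : ℕ → Prop) : ℕ := by
  classical
  -- The numbers counted are exactly those before the first success. Phrased as a count, the search
  -- falls under `PBP.card_filter`.
  exact ((Finset.range n).filter fun i => ∀ j < i + 1, ¬ r j).card

theorem leastBelow_spec {n : ℕ} {r : ℕ → Prop} (h : ∃ i < n, r i) : r (leastBelow n r) := by
  classical
  have h' : ∃ i, r i := h.imp fun _ h => h.2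
  have e : leastBelow n r = Nat.find h' := by
    have : ((Finset.range n).filter fun i => ∀ j < i + 1, ¬ r j) =
        Finset.range (Nat.find h') := by
      obtain ⟨i, hi, hri⟩ := h
      have := Nat.find_min' h' hri
      ext j
      simp only [Finset.mem_filter, Finset.mem_range, Nat.lt_find_iff]
      refine ⟨fun h k hk => h.2 k (by omega), fun h => ⟨?_, fun k hk => h k (by omega)⟩⟩
      by_contra hj
      exact h i (by omega) hri
    unfold leastBelow
    rw [this, Finset.card_range]
  rw [e]
  exact Nat.find_spec h'

theorem PB.leastBelow {α : Type} [Ctx α] {n : α → ℕ} {r : α → ℕ → Prop} (hn : PB n)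
    (hr : PBP fun x : α × ℕ => r x.1 x.2) : PB fun a => leastBelow (n a) (r a) := by
  classical
  exact PBP.card_filter hn (PBP.forall_lt (r := fun (x : α × ℕ) j => ¬ r x.1 j) last.succ
    (hr.not.reindex (φ := fun y : (α × ℕ) × ℕ => (y.1.1, y.2))
      ((Reindex.fst.comp Reindex.fst).pair Reindex.snd)))

/-! ### Machines that print a polynomial-time computable string -/

/-- The input of the algorithm. -/
structure Inp where
  n : ℕ
  a : ℕ
  b : ℕ

/-- The size of an input accounts for `2 ^ b`, so that numbers up to `2 ^ b` count as small. -/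
instance : Ctx Inp := ⟨Fin 4, inferInstance, fun x => ![x.n, x.a, x.b, 2 ^ x.b]⟩

theorem csize_inp (x : Inp) : csize x = x.n + x.a + x.b + 2 ^ x.b := Fin.sum_univ_four _

theorem PB.inp_n : PB fun x : Inp => x.n := PB.var (α := Inp) (0 : Fin 4)
theorem PB.inp_a : PB fun x : Inp => x.a := PB.var (α := Inp) (1 : Fin 4)
theorem PB.inp_b : PB fun x : Inp => x.b := PB.var (α := Inp) (2 : Fin 4)
theorem PB.inp_two_pow : PB fun x : Inp => 2 ^ x.b := PB.var (α := Inp) (3 : Fin 4)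

namespace Prog

theorem runs_read (k v : ℕ) {r r' : List Bool} (hr : r = [] ∧ r' = [] ∨ r = false :: r')
    (o : List Bool) (f : ℕ → ℕ) :
    Runs (.read (.inc k)) ⟨List.replicate v true ++ r, o, f⟩ (2 * v + 1)
      ⟨r', o, Function.update f k (f k + v)⟩ := by
  induction v generalizing f with
  | zero =>
    rcases hr with ⟨rfl, rfl⟩ | rfl
    · exact ⟨1, le_rfl, by simpa using Exec.read_nil (P := .inc k) (s := ⟨[], o, f⟩) rfl⟩
    · exact ⟨1, le_rfl, by
        simpa using Exec.read_false (P := .inc k) (s := ⟨false :: r', o, f⟩) rfl⟩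
  | succ v ih =>
    obtain ⟨t, ht, e⟩ := ih (Function.update f k (f k + 1))
    refine ⟨_, ?_, Exec.read_true (s := ⟨List.replicate (v + 1) true ++ r, o, f⟩) rfl
      (Exec.inc k _) (s'' := _) (t' := t) ?_⟩
    · omega
    · have : f k + (v + 1) = f k + 1 + v := by omega
      simpa [Store.set, this] using e

/-- Compute in counter `3` the power of two whose exponent is in counter `2`. -/
def twoPow : Prog :=
  .seq (copy 2 4 5) (.seq (.inc 3)
    (.loop 4 (.seq (.loop 3 (.seq (.inc 5) (.inc 5))) (move 5 3))))

theorem runs_twoPow (s : Store) (h : ∀ j, 3 ≤ j → s.reg j = 0) :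
    Runs twoPow s (6 * s.reg 2 + 3 + s.reg 2 * (8 * 2 ^ s.reg 2 + 4) + 4)
      (s.set 3 (2 ^ s.reg 2)) := by
  have double : ∀ s : Store, s.reg 5 = 0 →
      Runs (.seq (.loop 3 (.seq (.inc 5) (.inc 5))) (move 5 3)) s (8 * s.reg 3 + 3)
        (s.set 3 (2 * s.reg 3)) := by
    intro s h5
    have h1 := Runs.loop (k := 3) (P := .seq (.inc 5) (.inc 5)) (T := 3) (s.reg 3)
      (fun i => (s.set 3 (s.reg 3 - i)).set 5 (2 * i))
      (fun i _ => by rw [Store.set_reg_ne _ _ (by omega)]; simp) (fun i hi => by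
        have := (Runs.inc 5 (((s.set 3 (s.reg 3 - i)).set 5 (2 * i)).set 3
          (s.reg 3 - i - 1))).seq (Runs.inc 5 _)
        refine this.cast (Store.ext_reg rfl rfl fun x => ?_) le_rfl
        simp only [Store.set_reg_apply]
        split_ifs <;> omega)
    have e : (s.set 3 (s.reg 3 - 0)).set 5 (2 * 0) = s := by
      rw [Nat.sub_zero, Store.set_self, mul_zero, ← h5, Store.set_self]
    rw [e] at h1
    refine (h1.seq (runs_move (j := 5) (k := 3) (by omega) _)).cast
      (Store.ext_reg rfl rfl fun x => ?_) ?_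
    · simp only [Store.set_reg_apply]
      split_ifs <;> first | omega | simp_all
    · simp only [Store.set_reg_apply]
      simp
      omega
  have h1 := runs_copy (j := 2) (k := 4) (m := 5) (by omega) (by omega) (by omega) s
    (h 5 (by omega))
  have h2 := Runs.inc 3 (s.set 4 (s.reg 2))
  have h3 := Runs.loop (k := 4) (T := 8 * 2 ^ s.reg 2 + 3)
    (P := .seq (.loop 3 (.seq (.inc 5) (.inc 5))) (move 5 3)) (s.reg 2)
    (fun i => (s.set 4 (s.reg 2 - i)).set 3 (2 ^ i)) (fun i _ => by
      rw [Store.set_reg_ne _ _ (by omega)]; simp) (fun i hi => by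
      have := double (((s.set 4 (s.reg 2 - i)).set 3 (2 ^ i)).set 4 (s.reg 2 - i - 1)) (by
        simp [Store.set_reg_apply, h])
      refine this.cast (Store.ext_reg rfl rfl fun x => ?_) ?_
      · simp only [Store.set_reg_apply, pow_succ]
        split_ifs <;> omega
      · simp only [Store.set_reg_apply]
        have : 2 ^ i ≤ 2 ^ s.reg 2 := Nat.pow_le_pow_right (by omega) hi.le
        simp
        omega)
  have e1 : s.set 4 (s.reg 4 + s.reg 2) = s.set 4 (s.reg 2) := by rw [h 4 (by omega), zero_add]
  have e2 : (s.set 4 (s.reg 2)).set 3 ((s.set 4 (s.reg 2)).reg 3 + 1) =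
      (s.set 4 (s.reg 2 - 0)).set 3 (2 ^ 0) := by
    rw [Store.set_reg_ne _ _ (by omega), h 3 le_rfl]; rfl
  rw [e1] at h1
  rw [e2] at h2
  refine (h1.seq (h2.seq h3)).cast (Store.ext_reg rfl rfl fun x => ?_) (by
    rw [show 8 * 2 ^ s.reg 2 + 3 + 1 = 8 * 2 ^ s.reg 2 + 4 from rfl]; omega)
  have := h 4 (by omega)
  simp only [Store.set_reg_apply]
  split_ifs <;> simp_all

end Prog

/-- The list of the values of `f` at `0, …, k - 1`, read as bits. -/
def bitList (k : ℕ) (f : ℕ → ℕ) : List Bool := (List.range k).map fun i => decide (0 < f i)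

theorem bitList_drop {k i : ℕ} (hi : i < k) (f : ℕ → ℕ) :
    (bitList k f).drop (k - (i + 1)) =
      decide (0 < f (k - i - 1)) :: (bitList k f).drop (k - i) := by
  rw [List.drop_eq_getElem_cons (by simp [bitList]; omega)]
  have : k - (i + 1) + 1 = k - i := by omega
  rw [this]
  congr 1
  simp [bitList, Nat.sub_sub]

-- The last bit is computed first, because each `emit` pushes onto the output stack. Counters `0` to
-- `3` hold the input and `2 ^ b`; counter `4` is both the loop counter and the position passed to
-- the program for `bit`.
open Prog in
theorem exists_machine {len : Inp → ℕ} {bit : Inp → ℕ → ℕ} (hlen : PB len)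
    (hbit : PB fun p : Inp × ℕ => bit p.1 p.2) (hle : ∀ x i, bit x i ≤ 1) :
    ∃ M : Turing.TM2ComputableAux Bool Bool, (∀ k, Finite (M.tm.Γ k)) ∧
      ∃ q : Polynomial ℕ, ∀ n a b : ℕ, HaltsWithin M (encodeInput n a b)
        (bitList (len ⟨n, a, b⟩) (bit ⟨n, a, b⟩)) (q.eval (n + a + b + 2 ^ b)) := by
  obtain ⟨P, T, hT, hP⟩ := hlen (fun i : Fin 4 => (i : ℕ)) 4 (fun i => i.2)
  obtain ⟨Q, T', hT', hQ⟩ := hbit (Sum.elim (fun i : Fin 4 => (i : ℕ)) fun _ => 4) 5 (by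
    rintro (i | i)
    · exact i.2.trans (by omega)
    · exact (by omega : 4 < 5))
  obtain ⟨B, hB, hBT⟩ := hT'.exists_uniform hlen.polyBounded
  let R : Prog := .seq (.read (.inc 0)) (.seq (.read (.inc 1)) (.seq (.read (.inc 2))
    (.seq twoPow (.seq P (.seq (.loop 4 (.seq Q (.emit 5))) (.seq (clear 0) (.seq (clear 1)
      (.seq (clear 2) (clear 3)))))))))
  let time : Inp → ℕ := fun x => 20 + 4 * x.n + 4 * x.a + 10 * x.b + x.b * (8 * 2 ^ x.b + 4) +
    2 * 2 ^ x.b + 4 + T x + len x * (B x + 3) + 10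
  have htime : PolyBounded time := by
    have hn := PB.inp_n.polyBounded
    have ha := PB.inp_a.polyBounded
    have hb := PB.inp_b.polyBounded
    have hN := PB.inp_two_pow.polyBounded
    have c := fun k => PolyBounded.const (α := Inp) k
    exact ((((((((((c 20).add ((c 4).mul hn)).add ((c 4).mul ha)).add ((c 10).mul hb)).add
      (hb.mul (((c 8).mul hN).add (c 4)))).add ((c 2).mul hN)).add (c 4)).add hT).add
      (hlen.polyBounded.mul (hB.add (c 3)))).add (c 10))
  obtain ⟨q, hq⟩ := htime
  refine ⟨R.aux, fun k => inferInstanceAs (Finite Bool), q + 1, fun n a b => ?_⟩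
  set x : Inp := ⟨n, a, b⟩ with hx
  have hval : ∀ i : Fin 4, Ctx.val x i = ![n, a, b, 2 ^ b] i := fun i => rfl
  have key : Runs R ⟨encodeInput n a b, [], fun _ => 0⟩ (time x)
      ⟨[], bitList (len x) (bit x), fun _ => 0⟩ := by
    have r1 := runs_read 0 n (r := false :: (List.replicate a true ++ false ::
      List.replicate b true)) (r' := _) (Or.inr rfl) [] (fun _ => 0)
    have r2 := runs_read 1 a (r := false :: List.replicate b true) (r' := _) (Or.inr rfl) []
      (Function.update (fun _ => 0) 0 (0 + n))
    have r3 := runs_read 2 b (r := []) (r' := []) (Or.inl ⟨rfl, rfl⟩) []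
      (Function.update (Function.update (fun _ => 0) 0 (0 + n)) 1
        (Function.update (fun _ => 0) 0 (0 + n) 1 + a))
    rw [List.append_nil] at r3
    set s3 : Store := ⟨[], [], fun j => if j = 0 then n else if j = 1 then a else
      if j = 2 then b else 0⟩ with hs3
    have e3 : (⟨[], [], Function.update (Function.update (Function.update (fun _ => 0) 0 (0 + n)) 1
        (Function.update (fun _ => 0) 0 (0 + n) 1 + a)) 2 (Function.update (Function.update
        (fun _ => 0) 0 (0 + n)) 1 (Function.update (fun _ => 0) 0 (0 + n) 1 + a) 2 + b)⟩ : Store) =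
        s3 := by
      refine Store.ext_reg rfl rfl fun j => ?_
      rcases j with _ | _ | _ | j <;> simp [hs3]
    have r4 := runs_twoPow s3 (fun j hj => by
      simp only [hs3]
      rw [if_neg (by omega), if_neg (by omega), if_neg (by omega)])
    have hs32 : s3.reg 2 = b := by simp [hs3]
    rw [hs32] at r4
    set s4 : Store := s3.set 3 (2 ^ b) with hs4
    have hs4arg : ∀ i : Fin 4, s4.reg i = Ctx.val x i := by
      intro i
      rw [hval]
      fin_cases i <;> simp [hs4, hs3, Store.set_reg_apply]
    have hs40 : ∀ j, 4 ≤ j → s4.reg j = 0 := by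
      intro j hj
      simp only [hs4, hs3, Store.set_reg_apply]
      rw [if_neg (by omega), if_neg (by omega), if_neg (by omega), if_neg (by omega)]
    have r5 := hP x s4 hs4arg hs40
    let σ : ℕ → Store := fun i =>
      { s4.set 4 (len x - i) with out := (bitList (len x) (bit x)).drop (len x - i) }
    have hσ : ∀ i j, (σ i).reg j = (s4.set 4 (len x - i)).reg j := fun _ _ => rfl
    have r6 : Runs _ (σ 0) _ (σ (len x)) := Runs.loop (k := 4) (P := .seq Q (.emit 5))
      (T := B x + 2) (len x) σ (fun i _ => by rw [hσ]; simp) (fun i hi => by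
        have q1 := hQ (x, len x - i - 1) ((σ i).set 4 (len x - i - 1)) (by
          rintro (j | j)
          · have hj := j.2
            rw [Sum.elim_inl, Store.set_reg_ne _ _ (by omega), hσ, Store.set_reg_ne _ _ (by omega)]
            exact hs4arg j
          · simp; rfl) (fun j hj => by
            rw [Store.set_reg_ne _ _ (by omega), hσ, Store.set_reg_ne _ _ (by omega)]
            exact hs40 j (by omega))
        have q2 := q1.seq (⟨1, le_rfl, .emit 5 _⟩ : Runs (.emit 5) _ 1 _)
        -- `emit` only decrements counter `5`; as bits are at most one, this restores it to zero for
        -- the next round.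
        have hb := hle x (len x - i - 1)
        refine q2.cast (Store.ext_reg rfl ?_ fun j => ?_) ?_
        · simp only [σ]
          rw [bitList_drop hi]
          simp
        · have := hs40 5 (by omega)
          change ((((σ i).set 4 (len x - i - 1)).set 5 (bit x (len x - i - 1))).set 5 _).reg j = _
          rw [Store.set_set, Store.set_reg_same, hσ]
          simp only [Store.set_reg_apply, hσ]
          split_ifs <;> first | omega | simp_all
        · have := hBT x (len x - i - 1) (by omega)
          omega)
    have eσ0 : σ 0 = s4.set 4 (len x) := by
      simp only [σ, Nat.sub_zero]
      rw [List.drop_eq_nil_of_le (by simp [bitList])]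
      rfl
    rw [eσ0] at r6
    rw [e3] at r3
    refine (r1.seq (r2.seq (r3.seq (r4.seq (r5.seq (r6.seq ((runs_clear 0 _).seq
      ((runs_clear 1 _).seq ((runs_clear 2 _).seq (runs_clear 3 _)))))))))).cast
        (Store.ext_reg rfl ?_ fun j => ?_) ?_
    · simp [σ]
    · simp only [Store.set_reg_apply, hσ, hs4, hs3]
      split_ifs <;> omega
    · have c0 : s4.reg 0 = n := hs4arg 0
      have c1 : s4.reg 1 = a := hs4arg 1
      have c2 : s4.reg 2 = b := hs4arg 2
      have c3 : s4.reg 3 = 2 ^ b := hs4arg 3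
      simp only [Store.set_reg_apply, hσ]
      simp only [time, hx, c0, c1, c2, c3]
      simp
      ring_nf
      omega
  obtain ⟨t, ht, e⟩ := key
  obtain ⟨f⟩ := haltsWithin_of_exec e
  have h2 := hq x
  rw [csize_inp] at h2
  refine ⟨⟨f.toEvalsTo, f.steps_le_m.trans ?_⟩⟩
  simp only [Polynomial.eval_add, Polynomial.eval_one]
  exact Nat.add_le_add_right (ht.trans h2) 1

/-! ### The search for a sync sequence -/

/-- Bit `j` of the number `x`. -/
def bitAt (x j : ℕ) : ℕ := x / 2 ^ j % 2

/-- One step of the linear feedback shift register of length `b` with feedback `f`. -/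
def lfsrStep (b f w : ℕ) : ℕ :=
  w / 2 + 2 ^ b / 2 * ((∑ j ∈ Finset.range b, bitAt f j * bitAt w j) % 2)

/-- Bit `k` of the output of the shift register with feedback `f` and initial state `w`. -/
def lfsrBit (b f w k : ℕ) : ℕ := (lfsrStep b f)^[k] w % 2

/-- Digit `j` of the seed `s` in base `2 ^ b`. -/
def digit (b s j : ℕ) : ℕ := s / (2 ^ b) ^ j % 2 ^ b

/-- Entry `(r, c)` of the `i`-th matrix that belongs to the seed `s`. -/
def entry (l b s i r c : ℕ) : ℕ :=
  (∑ q ∈ Finset.range (l + 1), lfsrBit b (digit b s 0) (digit b s (1 + q)) (q * i + r + c) +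
    ∑ t ∈ Finset.range (l + 1),
      lfsrBit b (digit b s 0) (digit b s (l + 2 + t)) (2 ^ t * r + c)) % 2

/-- Coordinate `c` of the codeword of the message `x` in the `i`-th code. -/
def cwBit (l a b s i x c : ℕ) : ℕ :=
  (∑ r ∈ Finset.range a, bitAt x r * entry l b s i r c) % 2

/-- What is left of `z` after greedy matching with the string `g 0, …, g (k - 1)`. Strings are
written as numbers in binary, below a leading one. -/
def greedy (z : ℕ) (g : ℕ → ℕ) : ℕ → ℕ
  | 0 => z
  | c + 1 => if 2 ≤ greedy z g c ∧ greedy z g c % 2 = g c then greedy z g c / 2 else greedy z g c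

/-- The strings of length `b` given by `w` and `g` have a common subsequence of length at least
`b - k`. -/
def Close (b k w : ℕ) (g : ℕ → ℕ) : Prop :=
  ∃ z < 2 * 2 ^ b, 2 ^ b / 2 ^ k ≤ z ∧ greedy z (bitAt w) b = 1 ∧ greedy z g b = 1

open Classical in
/-- The condition that the search checks for the seed `s`. -/
def GoodSeed (l k n a b s : ℕ) : Prop :=
  -- For `a ≤ b` the bound is `2 ^ a`. In this form it stays at most `2 ^ b` for every input, so the
  -- check is polynomial in the size even when `a > b`.
  (∀ w < 2 ^ b, ((Finset.range n).filter fun i => ∃ x < 2 ^ b / 2 ^ (b - a),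
    x ≠ 0 ∧ Close b k w (cwBit l a b s i x)).card ≤ l) ∧
  (∀ i < n, ∀ w < 2 ^ b, ((Finset.range (2 ^ b / 2 ^ (b - a))).filter fun x =>
    Close b k w (cwBit l a b s i x)).card ≤ 2 ^ (l + 1)) ∧
  ∀ i < n, ∀ x < 2 ^ b / 2 ^ (b - a), x ≠ 0 → ∃ c < b, cwBit l a b s i x c ≠ 0

/-- The seed found by the search. -/
noncomputable def bestSeed (l k n a b : ℕ) : ℕ :=
  leastBelow ((2 ^ b) ^ (2 * l + 3)) (GoodSeed l k n a b)

/-! ### Polynomial-time evaluation and checking of seeds. -/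

variable {α : Type} [Ctx α]

theorem PB.bitAt {x j : α → ℕ} (hx : PB x) (hj : PB j) : PB fun e => bitAt (x e) (j e) :=
  (hx.shiftRight hj).parity

theorem PB.lfsrBit {b f w k : α → ℕ} (hb : PB b) (hN : PB fun e => 2 ^ b e) (hf : PB f)
    (hw : PB w) (hk : PB k) : PB fun e => lfsrBit (b e) (f e) (w e) (k e) := by
  refine PB.parity ?_
  refine natRec (F := fun e k => (lfsrStep (b e) (f e))^[k] (w e)) (g := w)
    (h := fun q => lfsrStep (b q.1.1) (f q.1.1) q.2) (B := fun e => w e + 2 ^ b e) hk hw ?_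
    (fun _ => rfl) (fun e i => Function.iterate_succ_apply' _ _ _)
    (hw.polyBounded.add hN.polyBounded) fun e i _ => ?_
  · exact last.half.add (hN.fst.fst.half.mul (parity (PB.sum hb.fst.fst
      (f := fun (q : (α × ℕ) × ℕ) j => SyncSeq.bitAt (f q.1.1) j * SyncSeq.bitAt q.2 j)
      ((hf.fst.fst.fst.bitAt last).mul (last.fst.bitAt last)))))
  -- The register never exceeds `w + 2 ^ b`: a step halves it and adds at most `2 ^ b / 2`.
  · induction i with
    | zero => simp
    | succ i ih =>
      rw [Function.iterate_succ_apply']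
      generalize (lfsrStep (b e) (f e))^[i] (w e) = y at ih
      unfold lfsrStep
      rcases Nat.mod_two_eq_zero_or_one
        (∑ j ∈ Finset.range (b e), SyncSeq.bitAt (f e) j * SyncSeq.bitAt y j) with h | h <;>
        rw [h] <;> omega

theorem PB.digit {b s : α → ℕ} (hN : PB fun e => 2 ^ b e) (hs : PB s) (j : ℕ) :
    PB fun e => digit (b e) (s e) j :=
  (hs.div (hN.pow j)).mod hN

theorem PB.entry {b s i r c : α → ℕ} (l : ℕ) (hb : PB b) (hN : PB fun e => 2 ^ b e) (hs : PB s)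
    (hi : PB i) (hr : PB r) (hc : PB c) :
    PB fun e => entry l (b e) (s e) (i e) (r e) (c e) :=
  ((sum_const (l + 1) fun q => PB.lfsrBit hb hN (PB.digit hN hs 0) (PB.digit hN hs (1 + q))
    ((((const q).mul hi).add hr).add hc)).add
      (sum_const (l + 1) fun t => PB.lfsrBit hb hN (PB.digit hN hs 0) (PB.digit hN hs (l + 2 + t))
        (((const (2 ^ t)).mul hr).add hc))).parity

theorem PB.cwBit {a b s i x c : α → ℕ} (l : ℕ) (ha : PB a) (hb : PB b)
    (hN : PB fun e => 2 ^ b e) (hs : PB s) (hi : PB i) (hx : PB x) (hc : PB c) :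
    PB fun e => cwBit l (a e) (b e) (s e) (i e) (x e) (c e) :=
  parity <| PB.sum ha (f := fun e r => SyncSeq.bitAt (x e) r *
    SyncSeq.entry l (b e) (s e) (i e) r (c e)) <|
    (hx.fst.bitAt last).mul (PB.entry l hb.fst hN.fst hs.fst hi.fst last hc.fst)

theorem greedy_le (z : ℕ) (g : ℕ → ℕ) (k : ℕ) : greedy z g k ≤ z := by
  induction k with
  | zero => exact le_rfl
  | succ k ih =>
    rw [greedy]
    split_ifs
    · exact (Nat.div_le_self _ _).trans ih
    · exact ih

theorem PB.greedy {z k : α → ℕ} {g : α → ℕ → ℕ} (hz : PB z) (hk : PB k)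
    (hg : PB fun p : α × ℕ => g p.1 p.2) : PB fun e => greedy (z e) (g e) (k e) :=
  natRec (F := fun e k => SyncSeq.greedy (z e) (g e) k) (g := z)
    (h := fun q => if 2 ≤ q.2 ∧ q.2 % 2 = g q.1.1 q.1.2 then q.2 / 2 else q.2) hk hz
    (((PBP.le (const 2) last).and (PBP.eq last.parity hg.fst)).ite last.half last)
    (fun _ => rfl) (fun _ _ => rfl) hz.polyBounded fun _ _ _ => greedy_le _ _ _

theorem PBP.close {b k w : α → ℕ} {g : α → ℕ → ℕ} (hb : PB b) (hN : PB fun e => 2 ^ b e)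
    (hk : PB k) (hw : PB w) (hg : PB fun p : α × ℕ => g p.1 p.2) :
    PBP fun e => Close (b e) (k e) (w e) (g e) := by
  have hg' : PB fun p : (α × ℕ) × ℕ => g p.1.1 p.2 := hg.reindex
    (φ := fun p : (α × ℕ) × ℕ => (p.1.1, p.2)) ((Reindex.fst.comp Reindex.fst).pair Reindex.snd)
  exact PBP.exists_lt ((PB.const 2).mul hN) <|
    (PBP.le (hN.shiftRight hk).fst PB.last).and <|
      (PBP.eq (PB.greedy (g := fun p : α × ℕ => bitAt (w p.1)) PB.last hb.fst
        (hw.fst.fst.bitAt PB.last)) (PB.const 1)).and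
      (PBP.eq (PB.greedy (g := fun p : α × ℕ => g p.1) PB.last hb.fst hg') (PB.const 1))

open Classical in
theorem PBP.goodSeed {k n a b s : α → ℕ} (l : ℕ) (hk : PB k) (hn : PB n) (ha : PB a) (hb : PB b)
    (hN : PB fun e => 2 ^ b e) (hs : PB s) :
    PBP fun e => GoodSeed l (k e) (n e) (a e) (b e) (s e) := by
  have hA : PB fun e => 2 ^ b e / 2 ^ (b e - a e) := hN.shiftRight (hb.sub ha)
  have close : ∀ {β : Type} [Ctx β] {φ : β → α} (_ : Reindex φ) {w i x : β → ℕ} (_ : PB w)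
      (_ : PB i) (_ : PB x), PBP fun e => Close (b (φ e)) (k (φ e)) (w e)
        (cwBit l (a (φ e)) (b (φ e)) (s (φ e)) (i e) (x e)) := by
    intro β _ φ hφ w i x hw hi hx
    exact PBP.close (hb.reindex hφ) (hN.reindex hφ) (hk.reindex hφ) hw
      (PB.cwBit l (ha.reindex hφ).fst (hb.reindex hφ).fst (hN.reindex hφ).fst (hs.reindex hφ).fst
        hi.fst hx.fst PB.last)
  have h1 : PBP fun e => ∀ w < 2 ^ b e, ((Finset.range (n e)).filter fun i =>
      ∃ x < 2 ^ b e / 2 ^ (b e - a e),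
        x ≠ 0 ∧ Close (b e) (k e) w (cwBit l (a e) (b e) (s e) i x)).card ≤ l :=
    PBP.forall_lt hN <| PBP.le (PBP.card_filter (r := fun (p : α × ℕ) i =>
      ∃ x < 2 ^ b p.1 / 2 ^ (b p.1 - a p.1), x ≠ 0 ∧ Close (b p.1) (k p.1) p.2
        (cwBit l (a p.1) (b p.1) (s p.1) i x)) hn.fst <|
      PBP.exists_lt hA.fst.fst <| (PBP.ne PB.last (PB.const 0)).and <|
        close (φ := fun p : ((α × ℕ) × ℕ) × ℕ => p.1.1.1)
          ((Reindex.fst.comp Reindex.fst).comp Reindex.fst) PB.last.fst.fst PB.last.fst PB.last)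
      (PB.const l)
  have h2 : PBP fun e => ∀ i < n e, ∀ w < 2 ^ b e,
      ((Finset.range (2 ^ b e / 2 ^ (b e - a e))).filter fun x =>
        Close (b e) (k e) w (cwBit l (a e) (b e) (s e) i x)).card ≤ 2 ^ (l + 1) :=
    PBP.forall_lt hn <| PBP.forall_lt hN.fst <| PBP.le (PBP.card_filter
      (r := fun (p : (α × ℕ) × ℕ) x => Close (b p.1.1) (k p.1.1) p.2
        (cwBit l (a p.1.1) (b p.1.1) (s p.1.1) p.1.2 x)) hA.fst.fst <|
      close (φ := fun p : ((α × ℕ) × ℕ) × ℕ => p.1.1.1)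
          ((Reindex.fst.comp Reindex.fst).comp Reindex.fst) PB.last.fst PB.last.fst.fst PB.last)
      (PB.const _)
  have h3 : PBP fun e => ∀ i < n e, ∀ x < 2 ^ b e / 2 ^ (b e - a e), x ≠ 0 →
      ∃ c < b e, cwBit l (a e) (b e) (s e) i x c ≠ 0 :=
    PBP.forall_lt hn <| PBP.forall_lt hA.fst <| (PBP.ne PB.last (PB.const 0)).imp <|
      PBP.exists_lt hb.fst.fst <| PBP.ne (PB.cwBit l ha.fst.fst.fst hb.fst.fst.fst hN.fst.fst.fst
        hs.fst.fst.fst PB.last.fst.fst PB.last.fst PB.last) (PB.const 0)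
  exact h1.and (h2.and h3)

/-- The entry at place `j` of the output of the algorithm, with `k = ⌊u b / v⌋` edits. -/
noncomputable def outBit (l u v : ℕ) (e : Inp) (j : ℕ) : ℕ :=
  entry l e.b (bestSeed l (u * e.b / v) e.n e.a e.b) (j / (e.a * e.b)) (j / e.b % e.a) (j % e.b)

theorem PB.outBit (l u v : ℕ) : PB fun p : Inp × ℕ => outBit l u v p.1 p.2 := by
  have hseed : PB fun e : Inp => bestSeed l (u * e.b / v) e.n e.a e.b :=
    PB.leastBelow (inp_two_pow.pow _) (PBP.goodSeed l (((const u).mul inp_b).div (const v)).fst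
      inp_n.fst inp_a.fst inp_b.fst inp_two_pow.fst last)
  exact PB.entry l inp_b.fst inp_two_pow.fst hseed.fst (last.div (inp_a.mul inp_b).fst)
    ((last.div inp_b.fst).mod inp_a.fst) (last.mod inp_b.fst)

theorem entry_le_one (l b s i r c : ℕ) : entry l b s i r c ≤ 1 :=
  Nat.le_of_lt_succ (Nat.mod_lt _ two_pos)

/-- The edit rate enters as a fraction `u / v` built into the machine; `δ` itself may not be
computable. -/
theorem exists_search_machine (l u v : ℕ) :
    ∃ M : Turing.TM2ComputableAux Bool Bool, (∀ k, Finite (M.tm.Γ k)) ∧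
      ∃ q : Polynomial ℕ, ∀ n a b : ℕ, HaltsWithin M (encodeInput n a b)
        (bitList (n * a * b) (outBit l u v ⟨n, a, b⟩)) (q.eval (n + a + b + 2 ^ b)) :=
  exists_machine (len := fun e => e.n * e.a * e.b) ((PB.inp_n.mul PB.inp_a).mul PB.inp_b)
    (PB.outBit l u v) fun _ _ => entry_le_one _ _ _ _ _ _

/-! ### Edit distance and common subsequences -/

/-- Drop the letter of `z` matched with the inserted `c`, if there is one. -/
theorem exists_sublist_of_sublist_insert {α : Type} {z u v : List α} {c : α}
    (h : z.Sublist (u ++ c :: v)) :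
    ∃ z' : List α, z'.Sublist z ∧ z'.Sublist (u ++ v) ∧ z.length ≤ z'.length + 1 := by
  obtain ⟨z₁, z₂, rfl, h1, h2⟩ := List.sublist_append_iff.1 h
  rcases List.sublist_cons_iff.1 h2 with h2 | ⟨z₃, rfl, h3⟩
  · exact ⟨z₁ ++ z₂, List.Sublist.refl _, h1.append h2, by simp⟩
  · exact ⟨z₁ ++ z₃, (List.Sublist.refl z₁).append (List.sublist_cons_self c z₃), h1.append h3,
      by simp; omega⟩

/-- The sum of the lengths minus twice the length of a longest common subsequence changes by at most
one per edit. -/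
theorem EditChain.exists_sublist {α : Type} {k : ℕ} {x y : List α} (h : EditChain k x y) :
    ∃ z : List α, z.Sublist x ∧ z.Sublist y ∧ x.length + y.length ≤ 2 * z.length + k := by
  induction h with
  | nil x => exact ⟨x, List.Sublist.refl _, List.Sublist.refl _, by omega⟩
  | cons hs _ ih =>
    obtain ⟨z, h1, h2, h3⟩ := ih
    cases hs with
    | ins u v c =>
      obtain ⟨z', h4, h5, h6⟩ := exists_sublist_of_sublist_insert h1
      refine ⟨z', h5, h4.trans h2, ?_⟩
      simp at h3 ⊢; omega
    | del u v c =>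
      refine ⟨z, h1.trans ((List.Sublist.refl u).append (List.sublist_cons_self c v)), h2, ?_⟩
      simp at h3 ⊢; omega

theorem EditChain.trans {α : Type} {j k : ℕ} {x y z : List α} (h : EditChain j x y)
    (h' : EditChain k y z) : EditChain (j + k) x z := by
  induction h with
  | nil x => simpa using h'
  | @cons j x y z hs _ ih =>
    rw [Nat.add_right_comm]
    exact .cons hs (ih h')

theorem EditStep.symm {α : Type} {x y : List α} (h : EditStep x y) : EditStep y x := by
  cases h with
  | ins u v c => exact .del u v c
  | del u v c => exact .ins u v c

theorem EditChain.symm {α : Type} {k : ℕ} {x y : List α} (h : EditChain k x y) :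
    EditChain k y x := by
  induction h with
  | nil x => exact .nil x
  | cons hs _ ih => exact ih.trans (.cons hs.symm (.nil _))

/-- `x` and `y` have a common subsequence of length at least `m`. -/
def CommonSub {α : Type} (m : ℕ) (x y : List α) : Prop :=
  ∃ z : List α, z.Sublist x ∧ z.Sublist y ∧ m ≤ z.length

/-- Passing through `v` takes at most `2 k` edits between two words of equal length `b`. The
infinitely many centres `v` can then be replaced by a codeword in the ball. -/
theorem commonSub_of_mem_editBall {b k : ℕ} {v : List (ZMod 2)} {r : ℝ} (hk : ⌊r⌋₊ ≤ k)
    {w w' : Fin b → ZMod 2} (hw : w ∈ editBall b v r) (hw' : w' ∈ editBall b v r) :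
    CommonSub (b - k) (List.ofFn w) (List.ofFn w') := by
  have h1 : editDist (List.ofFn w) v ≤ k := (Nat.le_floor hw).trans hk
  have h2 : editDist (List.ofFn w') v ≤ k := (Nat.le_floor hw').trans hk
  obtain ⟨z, hz, hz', hl⟩ := ((editChain_editDist (List.ofFn w) v).trans
    (editChain_editDist (List.ofFn w') v).symm).exists_sublist
  refine ⟨z, hz, hz', ?_⟩
  simp at hl
  omega

/-! ### Greedy matching -/

/-- The number with binary expansion `x`, least significant bit first, below a leading one. -/
def strCode : List (ZMod 2) → ℕ
  | [] => 1
  | c :: x => c.val + 2 * strCode x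

theorem two_pow_le_strCode (x : List (ZMod 2)) : 2 ^ x.length ≤ strCode x := by
  induction x with
  | nil => simp [strCode]
  | cons c x ih => simp only [strCode, List.length_cons, pow_succ]; omega

theorem strCode_lt (x : List (ZMod 2)) : strCode x < 2 ^ (x.length + 1) := by
  induction x with
  | nil => simp [strCode]
  | cons c x ih =>
    have := ZMod.val_lt c
    simp only [strCode, List.length_cons, pow_succ] at *; omega

theorem exists_strCode (n : ℕ) (hn : n ≠ 0) : ∃ x, strCode x = n := by
  induction n using Nat.strong_induction_on with
  | _ n ih =>
    rcases Nat.lt_or_ge n 2 with h | h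
    · exact ⟨[], by simp [strCode]; omega⟩
    · obtain ⟨x, hx⟩ := ih (n / 2) (by omega) (by omega)
      refine ⟨(n : ZMod 2) :: x, ?_⟩
      rw [strCode, hx, ZMod.val_natCast]
      omega

/-- The definition peels off the last letter of `g`; induction on sublists needs the first. -/
theorem greedy_succ (z : ℕ) (g : ℕ → ℕ) (k : ℕ) :
    greedy z g (k + 1) = greedy (greedy z g 1) (fun c => g (c + 1)) k := by
  induction k with
  | zero => rfl
  | succ k ih =>
    change (if 2 ≤ greedy z g (k + 1) ∧ greedy z g (k + 1) % 2 = g (k + 1) then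
      greedy z g (k + 1) / 2 else greedy z g (k + 1)) = _
    rw [ih]
    rfl

/-- Matching the first letter at its earliest occurrence loses nothing, so greedy matching succeeds
whenever an embedding exists. The value `1` is the bare leading one: the whole string has been
consumed. -/
theorem greedy_eq_one_iff (x : List (ZMod 2)) (g : ℕ → ZMod 2) (k : ℕ) :
    greedy (strCode x) (fun c => (g c).val) k = 1 ↔ x.Sublist ((List.range k).map g) := by
  induction k generalizing x g with
  | zero =>
    cases x with
    | nil => simp [greedy, strCode]
    | cons c x =>
      have := two_pow_le_strCode x
      have := Nat.one_le_two_pow (n := x.length)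
      simp [greedy, strCode]; omega
  | succ k ih =>
    rw [greedy_succ, List.range_succ_eq_map, List.map_cons, List.map_map]
    cases x with
    | nil =>
      have := ih [] (fun c => g (c + 1))
      simpa [greedy, strCode] using this
    | cons c x =>
      have h1 := two_pow_le_strCode x
      have h2 := Nat.one_le_two_pow (n := x.length)
      have h3 := ZMod.val_lt c
      have h4 : greedy (strCode (c :: x)) (fun c => (g c).val) 1 =
          if c = g 0 then strCode x else strCode (c :: x) := by
        have h5 : strCode (c :: x) % 2 = c.val := by simp only [strCode]; omega
        have h6 : strCode (c :: x) / 2 = strCode x := by simp only [strCode]; omega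
        have h7 : 2 ≤ strCode (c :: x) := by simp only [strCode]; omega
        simp only [greedy, h5, h6, h7, true_and, (ZMod.val_injective 2).eq_iff]
      rw [h4]
      split_ifs with h
      · rw [ih x (fun c => g (c + 1)), h, List.cons_sublist_cons]; rfl
      · rw [ih (c :: x) (fun c => g (c + 1)), List.sublist_cons_iff]
        constructor
        · exact fun h => Or.inl h
        · rintro (h' | ⟨r, h', _⟩)
          · exact h'
          · exact absurd (List.cons.inj h').1 h

/-- The string of the lowest `b` bits of `w`. -/
def bitVec (b w : ℕ) : Fin b → ZMod 2 := fun c => (bitAt w c : ZMod 2)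

theorem bitAt_lt_two (w c : ℕ) : bitAt w c < 2 := Nat.mod_lt _ two_pos

theorem val_cast_bit {x : ℕ} (h : x < 2) : (x : ZMod 2).val = x := ZMod.val_cast_of_lt h

/-- With the leading one, length at least `b - k` reads `2 ^ (b - k) ≤ z`, and length at most `b`,
automatic for a subsequence, gives `z < 2 * 2 ^ b`. -/
theorem close_iff {b k w : ℕ} {g : ℕ → ℕ} (hg : ∀ c, g c < 2) (hk : k ≤ b) :
    Close b k w g ↔
      CommonSub (b - k) (List.ofFn (bitVec b w)) (List.ofFn fun c : Fin b => (g c : ZMod 2)) := by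
  have e1 : ∀ h : ℕ → ℕ, (∀ c, h c < 2) → ∀ x, greedy (strCode x) h b = 1 ↔
      x.Sublist (List.ofFn fun c : Fin b => (h c : ZMod 2)) := by
    intro h hh x
    have h1 := greedy_eq_one_iff x (fun c => (h c : ZMod 2)) b
    have h2 : (fun c => ((h c : ZMod 2)).val) = h := funext fun c => val_cast_bit (hh c)
    rw [h2] at h1
    rw [h1, List.ofFn_eq_map, ← List.map_coe_finRange_eq_range, List.map_map]
    rfl
  have e2 : 2 ^ b / 2 ^ k = 2 ^ (b - k) := Nat.pow_div hk two_pos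
  unfold Close
  rw [e2]
  constructor
  · rintro ⟨z, hz, hkz, h1, h2⟩
    obtain ⟨x, rfl⟩ := exists_strCode z (by
      have := Nat.one_le_two_pow (n := b - k); omega)
    refine ⟨x, (e1 _ (bitAt_lt_two w) x).1 h1, (e1 _ hg x).1 h2, ?_⟩
    have := hkz.trans_lt (strCode_lt x)
    have := (Nat.pow_lt_pow_iff_right (by omega : 1 < 2)).1 this
    omega
  · rintro ⟨x, h1, h2, h3⟩
    refine ⟨strCode x, ?_, ?_, (e1 _ (bitAt_lt_two w) x).2 h1, (e1 _ hg x).2 h2⟩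
    · have hl := h1.length_le
      rw [List.length_ofFn] at hl
      calc strCode x < 2 ^ (x.length + 1) := strCode_lt x
        _ ≤ 2 ^ (b + 1) := Nat.pow_le_pow_right two_pos (by omega)
        _ = 2 * 2 ^ b := by ring
    · exact (Nat.pow_le_pow_right two_pos h3).trans (two_pow_le_strCode x)

/-! ### The number of strings that are close to a given one -/

-- Split the supersequences of `c :: x` by their first letter: either it is `c` and the rest
-- contains `x`, or the rest contains `c :: x`. The weight loses a factor `1 - p` in the first case
-- and `p` in the second, so the bound `1` is preserved. The hypothesis `p ≤ 1 / 2` serves the empty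
-- sequence, where `(2 p) ^ b ≤ 1`.
open Classical in
theorem card_supersequences_mul_le {p : ℝ} (hp0 : 0 ≤ p) (hp : p ≤ 1 / 2) (b : ℕ)
    (z : List (ZMod 2)) :
    ((Finset.univ.filter fun w : Fin b → ZMod 2 => z.Sublist (List.ofFn w)).card : ℝ) *
      (p ^ (b - z.length) * (1 - p) ^ z.length) ≤ 1 := by
  have hle : ∀ (b m : ℕ), p ^ (b - m) * (1 - p) ^ m ≤ 1 := fun b m =>
    mul_le_one₀ (pow_le_one₀ hp0 (by linarith)) (pow_nonneg (by linarith) _)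
      (pow_le_one₀ (by linarith) (by linarith))
  induction b generalizing z with
  | zero =>
    have : ((Finset.univ.filter fun w : Fin 0 → ZMod 2 => z.Sublist (List.ofFn w)).card : ℝ) ≤ 1 := by
      exact_mod_cast (Finset.card_le_univ _).trans (by simp)
    exact mul_le_one₀ this (mul_nonneg (pow_nonneg hp0 _) (pow_nonneg (by linarith) _)) (hle 0 _)
  | succ b ih =>
    cases z with
    | nil =>
      simp only [List.nil_sublist, Finset.filter_true, Finset.card_univ, List.length_nil,
        Nat.sub_zero, pow_zero, mul_one]
      rw [Fintype.card_fun, ZMod.card, Fintype.card_fin]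
      push_cast
      rw [← mul_pow]
      exact pow_le_one₀ (by linarith) (by linarith)
    | cons c x =>
      have hcard : (Finset.univ.filter fun w : Fin (b + 1) → ZMod 2 =>
          (c :: x).Sublist (List.ofFn w)).card ≤
          (Finset.univ.filter fun w : Fin b → ZMod 2 => x.Sublist (List.ofFn w)).card +
          (Finset.univ.filter fun w : Fin b → ZMod 2 => (c :: x).Sublist (List.ofFn w)).card := by
        rw [← Finset.card_map ⟨fun w : Fin b → ZMod 2 => (Fin.cons c w : Fin (b + 1) → ZMod 2),
            fun w w' h => by simpa using h⟩,
          ← Finset.card_map (s := Finset.univ.filter fun w : Fin b → ZMod 2 =>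
            (c :: x).Sublist (List.ofFn w)) ⟨fun w : Fin b → ZMod 2 =>
            (Fin.cons (c + 1) w : Fin (b + 1) → ZMod 2), fun w w' h => by simpa using h⟩]
        refine (Finset.card_le_card ?_).trans (Finset.card_union_le _ _)
        intro w hw
        simp only [Finset.mem_filter, Finset.mem_univ, true_and, Finset.mem_union,
          Finset.mem_map] at hw ⊢
        rw [List.ofFn_succ] at hw
        have hw0 : w 0 = c ∨ w 0 = c + 1 := by
          exact (by decide : ∀ c d : ZMod 2, d = c ∨ d = c + 1) c (w 0)
        rcases hw0 with h0 | h0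
        · left
          rw [h0, List.cons_sublist_cons] at hw
          exact ⟨Fin.tail w, hw, by rw [← h0]; exact Fin.cons_self_tail w⟩
        · right
          refine ⟨Fin.tail w, ?_, by rw [← h0]; exact Fin.cons_self_tail w⟩
          rcases List.sublist_cons_iff.1 hw with h | ⟨r, hr, _⟩
          · exact h
          · have := (List.cons.inj hr).1
            rw [h0] at this
            exact absurd this ((by decide : ∀ c : ZMod 2, c ≠ c + 1) c)
      have hcard' : ((Finset.univ.filter fun w : Fin (b + 1) → ZMod 2 =>
          (c :: x).Sublist (List.ofFn w)).card : ℝ) ≤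
          (Finset.univ.filter fun w : Fin b → ZMod 2 => x.Sublist (List.ofFn w)).card +
          (Finset.univ.filter fun w : Fin b → ZMod 2 => (c :: x).Sublist (List.ofFn w)).card := by
        exact_mod_cast hcard
      have hnn : 0 ≤ p ^ (b + 1 - (c :: x).length) * (1 - p) ^ (c :: x).length :=
        mul_nonneg (pow_nonneg hp0 _) (pow_nonneg (by linarith) _)
      refine (mul_le_mul_of_nonneg_right hcard' hnn).trans ?_
      have h1 := ih x
      have h2 := ih (c :: x)
      rw [add_mul]
      have e1 : p ^ (b + 1 - (c :: x).length) * (1 - p) ^ (c :: x).length =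
          (p ^ (b - x.length) * (1 - p) ^ x.length) * (1 - p) := by
        rw [List.length_cons, Nat.add_sub_add_right, pow_succ]; ring
      -- If `c :: x` is longer than `b`, truncated subtraction yields no factor `p`, but then the
      -- second family is empty.
      rcases Nat.lt_or_ge b (c :: x).length with hb | hb
      · have : (Finset.univ.filter fun w : Fin b → ZMod 2 =>
            (c :: x).Sublist (List.ofFn w)) = ∅ := by
          refine Finset.filter_false_of_mem fun w _ h => ?_
          have := h.length_le
          rw [List.length_ofFn] at this
          omega
        rw [this, e1]
        simp only [Finset.card_empty, Nat.cast_zero, zero_mul, add_zero]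
        rw [← mul_assoc]
        exact mul_le_one₀ h1 (by linarith) (by linarith)
      · have e2 : p ^ (b + 1 - (c :: x).length) * (1 - p) ^ (c :: x).length =
            (p ^ (b - (c :: x).length) * (1 - p) ^ (c :: x).length) * p := by
          rw [Nat.succ_sub hb, pow_succ]; ring
        conv_lhs => rw [e2]
        rw [← e2]
        nth_rewrite 1 [e1]
        rw [e2]
        nlinarith

/-- A single term of the binomial expansion of `(p + (1 - p)) ^ b`. -/
theorem choose_mul_le {p : ℝ} (hp0 : 0 ≤ p) (hp : p ≤ 1) {b k : ℕ} (hk : k ≤ b) :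
    (b.choose k : ℝ) * (p ^ k * (1 - p) ^ (b - k)) ≤ 1 := by
  have h := add_pow p (1 - p) b
  rw [add_sub_cancel, one_pow] at h
  refine le_trans (le_of_eq (by ring)) ((Finset.single_le_sum (f := fun m => p ^ m *
    (1 - p) ^ (b - m) * (b.choose m : ℝ)) (fun m _ => mul_nonneg (mul_nonneg (pow_nonneg hp0 _)
      (pow_nonneg (by linarith) _)) (Nat.cast_nonneg _))
        (Finset.mem_range.2 (by omega : k < b + 1))).trans h.symm.le)

open Classical in
/-- The strings of length `b` that share a long subsequence with `w`. -/
noncomputable def subBall (b k : ℕ) (w : Fin b → ZMod 2) : Finset (Fin b → ZMod 2) :=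
  Finset.univ.filter fun w' => CommonSub (b - k) (List.ofFn w) (List.ofFn w')

/-- A close word arises by choosing a subsequence of `w` of length `b - k` and then a supersequence
of it; each choice has at most `X⁻¹` possibilities. -/
theorem card_subBall_mul_le {p : ℝ} (hp0 : 0 < p) (hp : p ≤ 1 / 2) {b k : ℕ} (hk : k ≤ b)
    (w : Fin b → ZMod 2) :
    ((subBall b k w).card : ℝ) * (p ^ k * (1 - p) ^ (b - k)) ^ 2 ≤ 1 := by
  classical
  set X : ℝ := p ^ k * (1 - p) ^ (b - k) with hX
  have hXpos : 0 < X := mul_pos (pow_pos hp0 _) (pow_pos (by linarith) _)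
  have hsub : subBall b k w ⊆ (List.sublistsLen (b - k) (List.ofFn w)).toFinset.biUnion
      fun z => Finset.univ.filter fun w' : Fin b → ZMod 2 => z.Sublist (List.ofFn w') := by
    intro w' hw'
    obtain ⟨z, h1, h2, h3⟩ := (Finset.mem_filter.1 hw').2
    simp only [Finset.mem_biUnion, List.mem_toFinset, List.mem_sublistsLen, Finset.mem_filter,
      Finset.mem_univ, true_and]
    exact ⟨z.take (b - k), ⟨(List.take_sublist _ _).trans h1, by simpa using h3⟩,
      (List.take_sublist _ _).trans h2⟩
  have h1 : ((subBall b k w).card : ℝ) ≤ (b.choose k : ℝ) * X⁻¹ := by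
    calc ((subBall b k w).card : ℝ) ≤ ∑ z ∈ (List.sublistsLen (b - k) (List.ofFn w)).toFinset,
        ((Finset.univ.filter fun w' : Fin b → ZMod 2 => z.Sublist (List.ofFn w')).card : ℝ) := by
          exact_mod_cast (Finset.card_le_card hsub).trans Finset.card_biUnion_le
      _ ≤ ∑ z ∈ (List.sublistsLen (b - k) (List.ofFn w)).toFinset, X⁻¹ := by
          refine Finset.sum_le_sum fun z hz => ?_
          rw [List.mem_toFinset, List.mem_sublistsLen] at hz
          have := card_supersequences_mul_le hp0.le hp b z
          rw [hz.2, Nat.sub_sub_self hk] at this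
          rw [← one_div, le_div_iff₀ hXpos]
          exact this
      _ ≤ (b.choose k : ℝ) * X⁻¹ := by
          rw [Finset.sum_const, nsmul_eq_mul]
          refine mul_le_mul_of_nonneg_right ?_ (inv_nonneg.2 hXpos.le)
          have := List.toFinset_card_le (List.sublistsLen (b - k) (List.ofFn w))
          rw [List.length_sublistsLen, List.length_ofFn, Nat.choose_symm hk] at this
          exact_mod_cast this
  have h2 := choose_mul_le hp0.le (by linarith) hk
  calc ((subBall b k w).card : ℝ) * X ^ 2 ≤ ((b.choose k : ℝ) * X⁻¹) * X ^ 2 :=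
        mul_le_mul_of_nonneg_right h1 (sq_nonneg _)
    _ = (b.choose k : ℝ) * X := by field_simp
    _ ≤ 1 := h2

/-! ### Digits -/

theorem exists_digits (m k : ℕ) (d : ℕ → ℕ) (hd : ∀ j, d j < m) :
    ∃ s < m ^ k, ∀ j < k, s / m ^ j % m = d j := by
  induction k generalizing d with
  | zero => exact ⟨0, by simp, by simp⟩
  | succ k ih =>
    obtain ⟨s, hs, h⟩ := ih (fun j => d (j + 1)) fun j => hd _
    have hm : 0 < m := (Nat.zero_le _).trans_lt (hd 0)
    refine ⟨d 0 + m * s, ?_, fun j hj => ?_⟩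
    · calc d 0 + m * s < m + m * s := by have := hd 0; omega
        _ = m * (s + 1) := by ring
        _ ≤ m * m ^ k := Nat.mul_le_mul_left _ hs
        _ = m ^ (k + 1) := by ring
    · cases j with
      | zero => simp [Nat.mod_eq_of_lt (hd 0)]
      | succ j =>
        rw [pow_succ', ← Nat.div_div_eq_div_mul, Nat.add_mul_div_left _ _ hm,
          Nat.div_eq_of_lt (hd 0), zero_add]
        exact h j (by omega)

theorem exists_bitVec {b : ℕ} (v : Fin b → ZMod 2) : ∃ w < 2 ^ b, bitVec b w = v := by
  obtain ⟨w, hw, h⟩ := exists_digits 2 b (fun j => if h : j < b then (v ⟨j, h⟩).val else 0)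
    (fun j => by
      split_ifs with h
      · exact ZMod.val_lt _
      · omega)
  refine ⟨w, hw, funext fun c => ?_⟩
  have := h c c.2
  simp only [c.2, dif_pos] at this
  rw [bitVec, bitAt, this, ZMod.natCast_val, ZMod.cast_id]

theorem bitVec_injOn {b x y : ℕ} (hx : x < 2 ^ b) (hy : y < 2 ^ b) (h : bitVec b x = bitVec b y) :
    x = y := by
  refine Nat.eq_of_testBit_eq fun j => ?_
  rcases Nat.lt_or_ge j b with hj | hj
  · have := congrArg ZMod.val (congrFun h ⟨j, hj⟩)
    simp only [bitVec, val_cast_bit (bitAt_lt_two _ _)] at this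
    rw [Nat.testBit_eq_decide_div_mod_eq, Nat.testBit_eq_decide_div_mod_eq]
    exact congrArg (fun t => decide (t = 1)) this
  · have : 2 ^ b ≤ 2 ^ j := Nat.pow_le_pow_right two_pos hj
    rw [Nat.testBit_lt_two_pow (hx.trans_le this), Nat.testBit_lt_two_pow (hy.trans_le this)]

theorem bitVec_zero (b : ℕ) : bitVec b 0 = 0 := by
  funext c
  simp [bitVec, bitAt]

/-! ### Shift registers and finite fields -/

/-- A field with `2 ^ b` elements, a generator of its unit group, and a functional that reads off
coordinates. -/
structure RegisterField (b : ℕ) (K : Type) [Field K] [Algebra (ZMod 2) K] where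
  gen : K
  fn : K →ₗ[ZMod 2] ZMod 2
  feedback : Fin b → ZMod 2
  card : Nat.card K = 2 ^ b
  pow_injOn : ∀ i < 2 ^ b - 1, ∀ j < 2 ^ b - 1, gen ^ i = gen ^ j → i = j
  linearIndependent : LinearIndependent (ZMod 2) fun c : Fin b => gen ^ (c : ℕ)
  pow_eq : gen ^ b = ∑ c, feedback c • gen ^ (c : ℕ)
  injective : Function.Injective fun (y : K) (c : Fin b) => fn (y * gen ^ (c : ℕ))

/-- A generator of the unit group generates the field, so its first `b` powers form a basis; `fn` is
the coordinate of `1`. If `y ≠ y'` had the same string, `fn` would vanish on all multiples of `y -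
y'`, including `1`. -/
theorem exists_registerField {b : ℕ} (hb : b ≠ 0) :
    Nonempty (RegisterField b (GaloisField 2 b)) := by
  have : Fintype (GaloisField 2 b) := Fintype.ofFinite _
  obtain ⟨g, hg⟩ := IsCyclic.exists_generator (α := (GaloisField 2 b)ˣ)
  have hord : orderOf g = 2 ^ b - 1 := by
    rw [orderOf_eq_card_of_forall_mem_zpowers hg, Nat.card_units, GaloisField.card 2 b hb]
  have hpow : ∀ i < 2 ^ b - 1, ∀ j < 2 ^ b - 1,
      (g : GaloisField 2 b) ^ i = (g : GaloisField 2 b) ^ j → i = j := by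
    intro i hi j hj h
    rw [← hord] at hi hj
    refine pow_injOn_Iio_orderOf hi hj ?_
    exact Units.ext (by simpa using h)
  have htop : IntermediateField.adjoin (ZMod 2) {(g : GaloisField 2 b)} = ⊤ := by
    refine eq_top_iff.2 fun x _ => ?_
    by_cases hx : x = 0
    · rw [hx]; exact zero_mem _
    · obtain ⟨k, hk⟩ := mem_powers_iff_mem_zpowers.2 (hg (Units.mk0 x hx))
      have : x = (g : GaloisField 2 b) ^ k := by
        have := congrArg Units.val hk
        simpa using this.symm
      rw [this]
      exact pow_mem (IntermediateField.mem_adjoin_simple_self _ _) k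
  have hint : IsIntegral (ZMod 2) (g : GaloisField 2 b) := IsIntegral.of_finite _ _
  have hdeg : (minpoly (ZMod 2) (g : GaloisField 2 b)).natDegree = b := by
    rw [← IntermediateField.adjoin.finrank hint, htop, IntermediateField.finrank_top',
      GaloisField.finrank 2 hb]
  have hli : LinearIndependent (ZMod 2) fun c : Fin b => (g : GaloisField 2 b) ^ (c : ℕ) := by
    have := linearIndependent_pow (K := ZMod 2) (g : GaloisField 2 b)
    rwa [hdeg] at this
  have hspan : Submodule.span (ZMod 2)
      (Set.range fun c : Fin b => (g : GaloisField 2 b) ^ (c : ℕ)) = ⊤ :=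
    hli.span_eq_top_of_card_eq_finrank' (by rw [Fintype.card_fin, GaloisField.finrank 2 hb])
  obtain ⟨f, hf⟩ := (Submodule.mem_span_range_iff_exists_fun (ZMod 2)).1
    (hspan ▸ Submodule.mem_top : (g : GaloisField 2 b) ^ b ∈ Submodule.span (ZMod 2)
      (Set.range fun c : Fin b => (g : GaloisField 2 b) ^ (c : ℕ)))
  let B := Module.Basis.mk hli hspan.ge
  let z : Fin b := ⟨0, Nat.pos_of_ne_zero hb⟩
  have hB : B z = 1 := by simp [B, z]
  have hone : B.coord z 1 = 1 := by rw [← hB]; simp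
  refine ⟨⟨g, B.coord z, f, GaloisField.card 2 b hb, hpow, hli, hf.symm, ?_⟩⟩
  intro y y' hyy
  by_contra hne
  have h0 : ∀ x, B.coord z ((y - y') * x) = 0 := by
    intro x
    have hx : x ∈ Submodule.span (ZMod 2)
      (Set.range fun c : Fin b => (g : GaloisField 2 b) ^ (c : ℕ)) := hspan ▸ Submodule.mem_top
    induction hx using Submodule.span_induction with
    | mem x hx =>
      obtain ⟨c, rfl⟩ := hx
      rw [sub_mul, map_sub, sub_eq_zero]
      exact congrFun hyy c
    | zero => simp
    | add x x' _ _ h h' => rw [mul_add, map_add, h, h', add_zero]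
    | smul a x _ h => rw [mul_smul_comm, map_smul, h, smul_zero]
  have := h0 (y - y')⁻¹
  rw [mul_inv_cancel₀ (sub_ne_zero.2 hne), hone] at this
  exact one_ne_zero this

theorem lfsrStep_bits {b f w : ℕ} (hb : b ≠ 0) (hw : w < 2 ^ b) :
    lfsrStep b f w < 2 ^ b ∧ (∀ c, c + 1 < b → bitAt (lfsrStep b f w) c = bitAt w (c + 1)) ∧
      bitAt (lfsrStep b f w) (b - 1) = (∑ j ∈ Finset.range b, bitAt f j * bitAt w j) % 2 := by
  obtain ⟨d, rfl⟩ := Nat.exists_eq_succ_of_ne_zero hb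
  unfold lfsrStep
  generalize he : (∑ j ∈ Finset.range (d + 1), bitAt f j * bitAt w j) % 2 = e
  have he2 : e < 2 := he ▸ Nat.mod_lt _ two_pos
  have h1 : 2 ^ (d + 1) / 2 = 2 ^ d := by rw [pow_succ]; omega
  have h2 : w / 2 < 2 ^ d := by rw [Nat.succ_eq_add_one, pow_succ] at hw; omega
  rw [Nat.succ_eq_add_one, h1]
  refine ⟨?_, fun c hc => ?_, ?_⟩
  · rw [pow_succ]
    have : 2 ^ d * e ≤ 2 ^ d * 1 := Nat.mul_le_mul_left _ (by omega)
    omega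
  · obtain ⟨u, rfl⟩ : ∃ u, d = c + 1 + u := ⟨d - (c + 1), by omega⟩
    unfold bitAt
    rw [show 2 ^ (c + 1 + u) * e = 2 ^ c * (2 * (2 ^ u * e)) by rw [pow_add, pow_succ]; ring,
      Nat.add_mul_div_left _ _ (by positivity), Nat.add_mul_mod_self_left,
      Nat.div_div_eq_div_mul, pow_succ']
  · rw [Nat.add_sub_cancel, bitAt, Nat.add_mul_div_left _ _ (by positivity),
      Nat.div_eq_of_lt h2, zero_add, Nat.mod_eq_of_lt he2]

/-! ### Shift-register output as multiplication in the field. -/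

namespace RegisterField

variable {b : ℕ} {K : Type} [Field K] [Algebra (ZMod 2) K] (E : RegisterField b K)

/-- The string of length `b` that represents a field element. -/
def enc (y : K) : Fin b → ZMod 2 := fun c => E.fn (y * E.gen ^ (c : ℕ))

/-- After `k` steps the register holds the string of `y * gen ^ k`. Shifting is multiplication by
`gen`, and the new top bit is supplied by the relation expressing `gen ^ b` in lower powers. -/
theorem cast_lfsrBit (hb : b ≠ 0) {f w : ℕ} (hf : bitVec b f = E.feedback) (hw : w < 2 ^ b) {y : K}
    (hy : bitVec b w = E.enc y) (k : ℕ) :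
    (lfsrBit b f w k : ZMod 2) = E.fn (y * E.gen ^ k) := by
  have key : (lfsrStep b f)^[k] w < 2 ^ b ∧
      ∀ c < b, (bitAt ((lfsrStep b f)^[k] w) c : ZMod 2) = E.fn (y * E.gen ^ (k + c)) := by
    induction k with
    | zero =>
      refine ⟨hw, fun c hc => ?_⟩
      rw [zero_add]
      exact congrFun hy ⟨c, hc⟩
    | succ k ih =>
      obtain ⟨h1, h2⟩ := ih
      rw [Function.iterate_succ_apply']
      obtain ⟨h3, h4, h5⟩ := lfsrStep_bits (f := f) hb h1
      refine ⟨h3, fun c hc => ?_⟩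
      rcases Nat.lt_or_ge (c + 1) b with hc' | hc'
      · rw [h4 c hc', h2 _ hc']
        ring_nf
      · obtain rfl : c = b - 1 := by omega
        rw [h5, show k + 1 + (b - 1) = b + k by omega, pow_add, E.pow_eq, Finset.sum_mul,
          Finset.mul_sum, map_sum, ZMod.natCast_mod, Nat.cast_sum, Finset.sum_range]
        refine Finset.sum_congr rfl fun j _ => ?_
        rw [Nat.cast_mul, h2 j j.2, show (bitAt f j : ZMod 2) = E.feedback j from congrFun hf j,
          smul_mul_assoc, mul_smul_comm, map_smul, smul_eq_mul, ← pow_add, add_comm k]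
  have := key.2 0 (Nat.pos_of_ne_zero hb)
  simpa [bitAt, lfsrBit] using this

/-- The field element of a message. -/
def emb {a : ℕ} (v : Fin a → ZMod 2) : K := ∑ r, v r • E.gen ^ (r : ℕ)

theorem emb_sub {a : ℕ} (v v' : Fin a → ZMod 2) : E.emb (v - v') = E.emb v - E.emb v' := by
  simp [emb, sub_smul]

theorem emb_injective {a : ℕ} (ha : a ≤ b) :
    Function.Injective (E.emb : (Fin a → ZMod 2) → K) := by
  have hli : LinearIndependent (ZMod 2) fun r : Fin a => E.gen ^ (r : ℕ) :=
    E.linearIndependent.comp (Fin.castLE ha) (Fin.castLE_injective ha)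
  intro v v' h
  have h0 : E.emb (v - v') = 0 := by rw [emb_sub, h, sub_self]
  refine sub_eq_zero.1 (funext fun r => ?_)
  exact Fintype.linearIndependent_iff.1 hli _ h0 r

theorem emb_ne_zero {a : ℕ} (ha : a ≤ b) {v : Fin a → ZMod 2} (hv : v ≠ 0) : E.emb v ≠ 0 := by
  intro h
  exact hv (E.emb_injective ha (h.trans (by simp [emb])))

/-- The field element of the codeword of the message `X` in the `i`-th code. -/
def word {l : ℕ} (γ γ' : Fin (l + 1) → K) (i : ℕ) (X : K) : K :=
  ∑ q, γ q * (E.gen ^ i) ^ (q : ℕ) * X + ∑ t, γ' t * X ^ 2 ^ (t : ℕ)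

/-- Digit `0` of the seed is the feedback, the next `l + 1` digits encode `γ`, and the last `l + 1`
encode `γ'`. The entries are the codewords of the basis messages `gen ^ r`; additivity of the
Frobenius powers extends this to all messages. -/
theorem exists_seed (hb : b ≠ 0) {l : ℕ} (γ γ' : Fin (l + 1) → K) :
    ∃ s < (2 ^ b) ^ (2 * l + 3), ∀ a i x : ℕ,
      (fun c : Fin b => (cwBit l a b s i x c : ZMod 2)) =
        E.enc (E.word γ γ' i (E.emb (bitVec a x))) := by
  obtain ⟨f, hf, hff⟩ := exists_bitVec E.feedback
  choose num hnum hnum' using fun y : K => exists_bitVec (E.enc y)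
  obtain ⟨s, hs, hd⟩ := exists_digits (2 ^ b) (2 * l + 3) (fun j => if j = 0 then f else
    if h : j - 1 < l + 1 then num (γ ⟨j - 1, h⟩) else
      if h : j - (l + 2) < l + 1 then num (γ' ⟨j - (l + 2), h⟩) else 0) (fun j => by
      split_ifs
      · exact hf
      · exact hnum _
      · exact hnum _
      · positivity)
  have d0 : digit b s 0 = f := hd 0 (by omega)
  have d1 : ∀ q : Fin (l + 1), digit b s (1 + q) = num (γ q) := by
    intro q
    have := hd (1 + q) (by omega)
    rw [if_neg (by omega), dif_pos (by omega)] at this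
    rw [digit, this]
    congr 3; omega
  have d2 : ∀ t : Fin (l + 1), digit b s (l + 2 + t) = num (γ' t) := by
    intro t
    have := hd (l + 2 + t) (by omega)
    rw [if_neg (by omega), dif_neg (by omega), dif_pos (by omega)] at this
    rw [digit, this]
    congr 3; omega
  have hentry : ∀ i r c, (entry l b s i r c : ZMod 2) =
      E.fn ((∑ q, γ q * (E.gen ^ i) ^ (q : ℕ) * E.gen ^ r +
        ∑ t, γ' t * (E.gen ^ r) ^ 2 ^ (t : ℕ)) * E.gen ^ c) := by
    intro i r c
    rw [entry, ZMod.natCast_mod, Nat.cast_add, Nat.cast_sum, Nat.cast_sum, Finset.sum_range,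
      Finset.sum_range, add_mul, map_add, Finset.sum_mul, Finset.sum_mul, map_sum, map_sum]
    congr 1
    · refine Finset.sum_congr rfl fun q _ => ?_
      rw [d0, d1, E.cast_lfsrBit hb hff (hnum _) (hnum' _), pow_add, pow_add, pow_mul']
      simp only [mul_assoc]
    · refine Finset.sum_congr rfl fun t _ => ?_
      rw [d0, d2, E.cast_lfsrBit hb hff (hnum _) (hnum' _), pow_add, pow_mul']
      simp only [mul_assoc]
  refine ⟨s, hs, fun a i x => funext fun c => ?_⟩
  have : CharP K 2 := charP_of_injective_algebraMap (algebraMap (ZMod 2) K).injective 2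
  have hfrob : ∀ t : ℕ, (E.emb (bitVec a x)) ^ 2 ^ t =
      ∑ r : Fin a, bitVec a x r • (E.gen ^ (r : ℕ)) ^ 2 ^ t := by
    intro t
    rw [emb, sum_pow_char_pow]
    refine Finset.sum_congr rfl fun r _ => ?_
    rw [smul_pow]
    congr 1
    exact ZMod.pow_card_pow (p := 2) _
  rw [cwBit, ZMod.natCast_mod, Nat.cast_sum, Finset.sum_range]
  simp only [enc, word, hfrob]
  have e : (∑ q, γ q * (E.gen ^ i) ^ (q : ℕ) * E.emb (bitVec a x) +
      ∑ t : Fin (l + 1), γ' t * ∑ r : Fin a, bitVec a x r • (E.gen ^ (r : ℕ)) ^ 2 ^ (t : ℕ)) *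
      E.gen ^ (c : ℕ) = ∑ r : Fin a, bitVec a x r •
        ((∑ q, γ q * (E.gen ^ i) ^ (q : ℕ) * E.gen ^ (r : ℕ) +
          ∑ t : Fin (l + 1), γ' t * (E.gen ^ (r : ℕ)) ^ 2 ^ (t : ℕ)) * E.gen ^ (c : ℕ)) := by
    have e1 : ∑ q, γ q * (E.gen ^ i) ^ (q : ℕ) * E.emb (bitVec a x) = ∑ r : Fin a,
        bitVec a x r • ∑ q, γ q * (E.gen ^ i) ^ (q : ℕ) * E.gen ^ (r : ℕ) := by
      simp only [emb, Finset.mul_sum, Finset.smul_sum]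
      rw [Finset.sum_comm]
      simp only [mul_smul_comm]
    have e2 : ∑ t : Fin (l + 1), γ' t * ∑ r : Fin a, bitVec a x r •
        (E.gen ^ (r : ℕ)) ^ 2 ^ (t : ℕ) = ∑ r : Fin a,
        bitVec a x r • ∑ t : Fin (l + 1), γ' t * (E.gen ^ (r : ℕ)) ^ 2 ^ (t : ℕ) := by
      simp only [Finset.mul_sum, Finset.smul_sum]
      rw [Finset.sum_comm]
      simp only [mul_smul_comm]
    rw [e1, e2, ← Finset.sum_add_distrib, Finset.sum_mul]
    simp only [← smul_add, smul_mul_assoc]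
  rw [e, map_sum]
  refine Finset.sum_congr rfl fun r _ => ?_
  rw [Nat.cast_mul, hentry, map_smul, smul_eq_mul]
  rfl

end RegisterField

/-! ### Counting bad seeds -/

/-- An invertible affine map sends these coefficient vectors injectively into the box `∏ B j`. -/
theorem card_mulVec_add_mem_le {K : Type} [Field K] [Fintype K] [DecidableEq K] {m : ℕ}
    {M : Matrix (Fin m) (Fin m) K} (hM : M.det ≠ 0) (o : Fin m → K) (B : Fin m → Finset K) :
    (Finset.univ.filter fun γ : Fin m → K => ∀ j, M.mulVec γ j + o j ∈ B j).card ≤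
      ∏ j, (B j).card := by
  rw [← Fintype.card_piFinset]
  refine Finset.card_le_card_of_injOn (fun γ => M.mulVec γ + o) (fun γ hγ => ?_)
    fun γ _ γ' _ h => ?_
  · simpa using hγ
  · have h1 : M.mulVec γ = M.mulVec γ' := add_right_cancel h
    exact Matrix.mulVec_injective_of_isUnit
      ((Matrix.isUnit_iff_isUnit_det M).2 (isUnit_iff_ne_zero.2 hM)) h1

theorem card_filter_prod_le {A B : Type} [Fintype A] [Fintype B] {P : A → B → Prop}
    [∀ x, DecidablePred (P x)] {c : ℕ}
    (h : ∀ y, (Finset.univ.filter fun x => P x y).card ≤ c) :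
    (Finset.univ.filter fun p : A × B => P p.1 p.2).card ≤ c * Fintype.card B := by
  rw [Finset.card_filter, Fintype.sum_prod_type_right]
  refine (Finset.sum_le_card_nsmul _ _ c fun y _ => ?_).trans (by rw [smul_eq_mul, mul_comm]; rfl)
  rw [← Finset.card_filter]
  exact h y

theorem card_filter_prod_le' {A B : Type} [Fintype A] [Fintype B] {P : A → B → Prop}
    [∀ x, DecidablePred (P x)] {c : ℕ}
    (h : ∀ x, (Finset.univ.filter fun y => P x y).card ≤ c) :
    (Finset.univ.filter fun p : A × B => P p.1 p.2).card ≤ c * Fintype.card A := by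
  rw [Finset.card_filter, Fintype.sum_prod_type]
  refine (Finset.sum_le_card_nsmul _ _ c fun y _ => ?_).trans (by rw [smul_eq_mul, mul_comm]; rfl)
  rw [← Finset.card_filter]
  exact h y

theorem det_scaled_vandermonde_ne_zero {K : Type} [Field K] {m : ℕ} {u X : Fin m → K}
    (hu : Function.Injective u) (hX : ∀ j, X j ≠ 0) :
    (Matrix.of fun j q : Fin m => u j ^ (q : ℕ) * X j).det ≠ 0 := by
  have : (Matrix.of fun j q : Fin m => u j ^ (q : ℕ) * X j) =
      Matrix.diagonal X * Matrix.vandermonde u := by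
    ext j q
    rw [Matrix.diagonal_mul, Matrix.of_apply, Matrix.vandermonde_apply, mul_comm]
  rw [this, Matrix.det_mul, Matrix.det_diagonal]
  exact mul_ne_zero (Finset.prod_ne_zero_iff.2 fun j _ => hX j)
    (Matrix.det_vandermonde_ne_zero_iff.2 hu)

/-- The Moore matrix of linearly independent elements is nonsingular. -/
theorem det_moore_ne_zero {K : Type} [Field K] [Algebra (ZMod 2) K] {l : ℕ}
    {X : Fin (l + 1) → K} (hX : LinearIndependent (ZMod 2) X) :
    (Matrix.of fun j t : Fin (l + 1) => X j ^ 2 ^ (t : ℕ)).det ≠ 0 := by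
  intro hdet
  have : CharP K 2 := charP_of_injective_algebraMap (algebraMap (ZMod 2) K).injective 2
  obtain ⟨c, hc0, hc⟩ := Matrix.exists_mulVec_eq_zero_iff.2 hdet
  -- A kernel vector gives an additive polynomial of degree at most `2 ^ l`. It vanishes at every `X
  -- j`, hence on all `2 ^ (l + 1)` elements of their span, so it is zero.
  let p : Polynomial K := ∑ t : Fin (l + 1), Polynomial.C (c t) * Polynomial.X ^ 2 ^ (t : ℕ)
  have heval : ∀ y, p.eval y = ∑ t : Fin (l + 1), c t * y ^ 2 ^ (t : ℕ) := by
    intro y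
    simp [p, Polynomial.eval_finsetSum]
  have hroot : ∀ v : Fin (l + 1) → ZMod 2, p.eval (∑ j, v j • X j) = 0 := by
    intro v
    rw [heval]
    have h1 : ∀ t : ℕ, (∑ j, v j • X j) ^ 2 ^ t = ∑ j, v j • X j ^ 2 ^ t := by
      intro t
      rw [sum_pow_char_pow]
      refine Finset.sum_congr rfl fun j _ => ?_
      rw [smul_pow]
      congr 1
      exact ZMod.pow_card_pow (p := 2) _
    simp only [h1, Finset.mul_sum]
    rw [Finset.sum_comm]
    refine Finset.sum_eq_zero fun j _ => ?_
    have h2 : ∑ t : Fin (l + 1), X j ^ 2 ^ (t : ℕ) * c t = 0 := congrFun hc j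
    simp only [mul_smul_comm]
    rw [← Finset.smul_sum]
    simp only [mul_comm (c _), h2, smul_zero]
  have hinj : Function.Injective fun v : Fin (l + 1) → ZMod 2 => ∑ j, v j • X j := by
    intro v v' h
    refine sub_eq_zero.1 (funext fun j => ?_)
    refine Fintype.linearIndependent_iff.1 hX (v - v') ?_ j
    simp only [Pi.sub_apply, sub_smul, Finset.sum_sub_distrib]
    exact sub_eq_zero.2 h
  have hdeg : p.natDegree ≤ 2 ^ l := by
    refine Polynomial.natDegree_sum_le_of_forall_le _ _ fun t _ => ?_
    refine (Polynomial.natDegree_C_mul_X_pow_le _ _).trans ?_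
    exact Nat.pow_le_pow_right two_pos (Nat.le_of_lt_succ t.2)
  have hp : p = 0 := by
    refine Polynomial.eq_zero_of_natDegree_lt_card_of_eval_eq_zero p hinj hroot ?_
    rw [Fintype.card_fun, ZMod.card, Fintype.card_fin]
    exact hdeg.trans_lt (Nat.pow_lt_pow_right (by omega) (by omega))
  refine hc0 (funext fun t => ?_)
  have hcoeff := congrArg (fun r => Polynomial.coeff r (2 ^ (t : ℕ))) hp
  simp only [p, Polynomial.finsetSum_coeff, Polynomial.coeff_C_mul, Polynomial.coeff_X_pow,
    Polynomial.coeff_zero] at hcoeff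
  rw [Finset.sum_eq_single t] at hcoeff
  · simpa using hcoeff
  · intro t' _ ht
    have : (2 : ℕ) ^ (t : ℕ) ≠ 2 ^ (t' : ℕ) := fun h =>
      ht (Fin.ext (Nat.pow_right_injective le_rfl h).symm)
    simp [this]
  · simp

/-- A space spanned by at most `l + 1` vectors over `𝔽₂` has at most `2 ^ (l + 1)` elements. -/
theorem exists_linearIndependent_of_card {a l : ℕ} {T : Finset (Fin a → ZMod 2)}
    (hT : 2 ^ (l + 1) < T.card) :
    ∃ v : Fin (l + 1) → Fin a → ZMod 2, LinearIndependent (ZMod 2) v ∧ ∀ j, v j ∈ T := by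
  obtain ⟨f, hf, -, hli⟩ := Submodule.exists_fun_fin_finrank_span_eq (ZMod 2)
    (T : Set (Fin a → ZMod 2))
  have hcard : T.card ≤ 2 ^ Module.finrank (ZMod 2)
      (Submodule.span (ZMod 2) (T : Set (Fin a → ZMod 2))) := by
    have h1 := Module.natCard_eq_pow_finrank (K := ZMod 2)
      (V := Submodule.span (ZMod 2) (T : Set (Fin a → ZMod 2)))
    rw [Nat.card_eq_fintype_card (α := ZMod 2), ZMod.card] at h1
    rw [← h1, ← Set.ncard_coe_finset T]
    exact Set.ncard_le_ncard Submodule.subset_span (Set.toFinite _)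
  have hle : l + 1 ≤ Module.finrank (ZMod 2)
      (Submodule.span (ZMod 2) (T : Set (Fin a → ZMod 2))) :=
    ((Nat.pow_lt_pow_iff_right (by omega : 1 < 2)).1 (hT.trans_le hcard)).le
  exact ⟨fun j => f (Fin.castLE hle j), hli.comp _ (Fin.castLE_injective hle), fun j => hf _⟩

/-! ### Independence of codewords and the union bound. -/

namespace RegisterField

variable {b l : ℕ} {K : Type} [Field K] [Algebra (ZMod 2) K] (E : RegisterField b K)

theorem word_eq_left (γ γ' : Fin (l + 1) → K) (i : Fin (l + 1) → ℕ) (X : Fin (l + 1) → K)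
    (j : Fin (l + 1)) : E.word γ γ' (i j) (X j) =
      (Matrix.of fun j q : Fin (l + 1) => (E.gen ^ i j) ^ (q : ℕ) * X j).mulVec γ j +
        ∑ t, γ' t * X j ^ 2 ^ (t : ℕ) := by
  rw [word]
  congr 1
  refine Finset.sum_congr rfl fun q _ => ?_
  change _ = (E.gen ^ i j) ^ (q : ℕ) * X j * γ q
  ring

theorem word_eq_right (γ γ' : Fin (l + 1) → K) (i : Fin (l + 1) → ℕ) (X : Fin (l + 1) → K)
    (j : Fin (l + 1)) : E.word γ γ' (i j) (X j) =
      (Matrix.of fun j t : Fin (l + 1) => X j ^ 2 ^ (t : ℕ)).mulVec γ' j +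
        ∑ q, γ q * (E.gen ^ i j) ^ (q : ℕ) * X j := by
  rw [word, add_comm]
  congr 1
  refine Finset.sum_congr rfl fun t _ => ?_
  exact mul_comm _ _

variable [Fintype K]

open Classical in
/-- The field elements whose strings lie in `S`. -/
noncomputable def encMem (S : Finset (Fin b → ZMod 2)) : Finset K :=
  Finset.univ.filter fun y => E.enc y ∈ S

theorem card_encMem_le (S : Finset (Fin b → ZMod 2)) : (E.encMem S).card ≤ S.card := by
  classical
  exact Finset.card_le_card_of_injOn E.enc (fun y hy => (Finset.mem_filter.1 hy).2)
    E.injective.injOn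

theorem fintype_card (E : RegisterField b K) : Fintype.card K = 2 ^ b := by rw [← Nat.card_eq_fintype_card, E.card]

-- For each fixed `γ'` the codewords are a shifted scaled Vandermonde image of `γ`. The nodes `gen ^
-- i j` are distinct because the exponents lie below the order `2 ^ b - 1`.
open Classical in
theorem card_word_mem_le {i : Fin (l + 1) → ℕ} (hi : Function.Injective i)
    (hib : ∀ j, i j < 2 ^ b - 1) {X : Fin (l + 1) → K} (hX : ∀ j, X j ≠ 0)
    (B : Fin (l + 1) → Finset K) :
    (Finset.univ.filter fun p : (Fin (l + 1) → K) × (Fin (l + 1) → K) =>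
      ∀ j, E.word p.1 p.2 (i j) (X j) ∈ B j).card ≤ (∏ j, (B j).card) * (2 ^ b) ^ (l + 1) := by
  have hM := det_scaled_vandermonde_ne_zero (u := fun j => E.gen ^ i j)
    (fun j j' h => hi (E.pow_injOn _ (hib j) _ (hib j') h)) hX
  have := card_filter_prod_le (P := fun γ γ' => ∀ j, E.word γ γ' (i j) (X j) ∈ B j)
    (fun γ' => (Finset.card_le_card fun γ h => Finset.mem_filter.2 ⟨Finset.mem_univ _, fun j => by
      rw [← E.word_eq_left γ γ' i X j]; exact (Finset.mem_filter.1 h).2 j⟩).trans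
        (card_mulVec_add_mem_le hM (fun j => ∑ t, γ' t * X j ^ 2 ^ (t : ℕ)) B))
  rwa [Fintype.card_fun, Fintype.card_fin, E.fintype_card] at this

-- Here `γ` is fixed and the Moore matrix acts on `γ'`, so the indices `i` may coincide.
open Classical in
theorem card_word_mem_le' (i : Fin (l + 1) → ℕ) {X : Fin (l + 1) → K}
    (hX : LinearIndependent (ZMod 2) X) (B : Fin (l + 1) → Finset K) :
    (Finset.univ.filter fun p : (Fin (l + 1) → K) × (Fin (l + 1) → K) =>
      ∀ j, E.word p.1 p.2 (i j) (X j) ∈ B j).card ≤ (∏ j, (B j).card) * (2 ^ b) ^ (l + 1) := by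
  have := card_filter_prod_le' (P := fun γ γ' => ∀ j, E.word γ γ' (i j) (X j) ∈ B j)
    (fun γ => (Finset.card_le_card fun γ' h => Finset.mem_filter.2 ⟨Finset.mem_univ _, fun j => by
      rw [← E.word_eq_right γ γ' i X j]; exact (Finset.mem_filter.1 h).2 j⟩).trans
        (card_mulVec_add_mem_le (det_moore_ne_zero hX)
          (fun j => ∑ q, γ q * (E.gen ^ i j) ^ (q : ℕ) * X j) B))
  rwa [Fintype.card_fun, Fintype.card_fin, E.fintype_card] at this

open Classical in
/-- The coefficients for which the codewords of `v` in the codes `i` are all close to `w`. -/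
noncomputable def bad {n a : ℕ} (k : ℕ) (i : Fin (l + 1) → Fin n)
    (v : Fin (l + 1) → Fin a → ZMod 2) (w : Fin b → ZMod 2) :
    Finset ((Fin (l + 1) → K) × (Fin (l + 1) → K)) :=
  Finset.univ.filter fun p => ∀ j, E.word p.1 p.2 (i j) (E.emb (v j)) ∈ E.encMem (subBall b k w)

theorem prod_card_encMem_le {k V : ℕ} (hV : ∀ w : Fin b → ZMod 2, (subBall b k w).card ≤ V)
    (w : Fin b → ZMod 2) :
    ∏ _j : Fin (l + 1), (E.encMem (subBall b k w)).card ≤ V ^ (l + 1) := by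
  rw [Finset.prod_const, Finset.card_univ, Fintype.card_fin]
  exact Nat.pow_le_pow_left ((E.card_encMem_le _).trans (hV w)) _

/-- A union bound: some coefficients avoid all bad events. -/
theorem exists_avoiding {n a k V : ℕ} (ha : a ≤ b) (hn : n + l < 2 ^ b)
    (hV : ∀ w : Fin b → ZMod 2, (subBall b k w).card ≤ V)
    (hcount : n ^ (l + 1) * (2 ^ a) ^ (l + 1) * 2 ^ b * (V ^ (l + 1) * (2 ^ b) ^ (l + 1)) +
      n * (2 ^ a) ^ (l + 1) * 2 ^ b * (V ^ (l + 1) * (2 ^ b) ^ (l + 1)) +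
      n * 2 ^ a * ((2 ^ b) ^ l * (2 ^ b) ^ (l + 1)) < (2 ^ b) ^ (l + 1) * (2 ^ b) ^ (l + 1)) :
    ∃ p : (Fin (l + 1) → K) × (Fin (l + 1) → K),
      (∀ (i : Fin (l + 1) → Fin n) (v : Fin (l + 1) → Fin a → ZMod 2) (w : Fin b → ZMod 2),
        Function.Injective i → (∀ j, v j ≠ 0) → p ∉ E.bad k i v w) ∧
      (∀ (i : Fin n) (v : Fin (l + 1) → Fin a → ZMod 2) (w : Fin b → ZMod 2),
        LinearIndependent (ZMod 2) v → p ∉ E.bad k (fun _ => i) v w) ∧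
      ∀ (i : Fin n) (v : Fin a → ZMod 2), v ≠ 0 → E.word p.1 p.2 i (E.emb v) ≠ 0 := by
  classical
  let S1 := (Finset.univ : Finset ((Fin (l + 1) → Fin n) × (Fin (l + 1) → Fin a → ZMod 2) ×
    (Fin b → ZMod 2))).biUnion fun t =>
      if Function.Injective t.1 ∧ ∀ j, t.2.1 j ≠ 0 then E.bad k t.1 t.2.1 t.2.2 else ∅
  let S2 := (Finset.univ : Finset (Fin n × (Fin (l + 1) → Fin a → ZMod 2) ×
    (Fin b → ZMod 2))).biUnion fun t =>
      if LinearIndependent (ZMod 2) t.2.1 then E.bad k (fun _ => t.1) t.2.1 t.2.2 else ∅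
  let S3 := (Finset.univ : Finset (Fin n × (Fin a → ZMod 2))).biUnion fun t =>
      if t.2 ≠ 0 then Finset.univ.filter fun p : (Fin (l + 1) → K) × (Fin (l + 1) → K) =>
        E.word p.1 p.2 t.1 (E.emb t.2) = 0 else ∅
  have hS1 : S1.card ≤ n ^ (l + 1) * (2 ^ a) ^ (l + 1) * 2 ^ b *
      (V ^ (l + 1) * (2 ^ b) ^ (l + 1)) := by
    refine (Finset.card_biUnion_le_card_mul _ _ (V ^ (l + 1) * (2 ^ b) ^ (l + 1))
      fun t _ => ?_).trans (le_of_eq ?_)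
    · split_ifs with h
      · refine (E.card_word_mem_le (i := fun j => t.1 j) (Fin.val_injective.comp h.1)
          (fun j => by omega) (fun j => E.emb_ne_zero ha (h.2 j)) _).trans ?_
        exact Nat.mul_le_mul_right _ (E.prod_card_encMem_le hV _)
      · simp
    · simp [Fintype.card_prod, ZMod.card, mul_assoc]
  have hS2 : S2.card ≤ n * (2 ^ a) ^ (l + 1) * 2 ^ b *
      (V ^ (l + 1) * (2 ^ b) ^ (l + 1)) := by
    refine (Finset.card_biUnion_le_card_mul _ _ (V ^ (l + 1) * (2 ^ b) ^ (l + 1))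
      fun t _ => ?_).trans (le_of_eq ?_)
    · split_ifs with h
      · have hli : LinearIndependent (ZMod 2) fun j => E.emb (t.2.1 j) := by
          rw [Fintype.linearIndependent_iff] at h ⊢
          intro c hc j
          refine h c (E.emb_injective ha ?_) j
          refine Eq.trans ?_ (hc.trans (by simp [emb]))
          simp only [emb, Finset.smul_sum, Finset.sum_apply, Pi.smul_apply, Finset.sum_smul]
          rw [Finset.sum_comm]
          simp only [smul_assoc]
        refine (E.card_word_mem_le' (fun _ => t.1) hli _).trans ?_
        exact Nat.mul_le_mul_right _ (E.prod_card_encMem_le hV _)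
      · simp
    · simp [Fintype.card_prod, ZMod.card, mul_assoc]
  have hS3 : S3.card ≤ n * 2 ^ a * ((2 ^ b) ^ l * (2 ^ b) ^ (l + 1)) := by
    refine (Finset.card_biUnion_le_card_mul _ _ ((2 ^ b) ^ l * (2 ^ b) ^ (l + 1))
      fun t _ => ?_).trans (le_of_eq ?_)
    · split_ifs with h
      -- A single codeword is padded to `l + 1` of them, with indices `i, …, i + l`, the extra ones
      -- unconstrained. Keeping these indices below `2 ^ b - 1` is what `n + l < 2 ^ b` is for.
      · have h1 := E.card_word_mem_le (i := fun j : Fin (l + 1) => t.1 + j)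
          (fun j j' h => Fin.ext (Nat.add_left_cancel h)) (fun j => by omega)
          (X := fun _ => E.emb t.2) (fun _ => E.emb_ne_zero ha h)
          (Fin.cons {0} fun _ => Finset.univ)
        rw [Fin.prod_univ_succ] at h1
        simp only [Fin.cons_zero, Finset.card_singleton, one_mul, Fin.cons_succ,
          Finset.prod_const, Finset.card_univ, Fintype.card_fin, E.fintype_card] at h1
        refine le_trans (Finset.card_le_card fun p hp => ?_) h1
        refine Finset.mem_filter.2 ⟨Finset.mem_univ _, fun j => ?_⟩
        refine Fin.cases ?_ (fun j => ?_) j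
        · simpa using (Finset.mem_filter.1 hp).2
        · simp
      · simp
    · simp [Fintype.card_prod, ZMod.card]
  have hlt : (S1 ∪ S2 ∪ S3).card < Fintype.card ((Fin (l + 1) → K) × (Fin (l + 1) → K)) := by
    rw [Fintype.card_prod, Fintype.card_fun, Fintype.card_fin, E.fintype_card]
    have h1 := Finset.card_union_le (S1 ∪ S2) S3
    have h2 := Finset.card_union_le S1 S2
    omega
  obtain ⟨p, hp⟩ : ∃ p, p ∉ S1 ∪ S2 ∪ S3 := by
    by_contra! h
    rw [Finset.eq_univ_of_forall h, Finset.card_univ] at hlt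
    exact lt_irrefl _ hlt
  simp only [Finset.mem_union, not_or] at hp
  refine ⟨p, fun i v w hi hv hb => hp.1.1 ?_, fun i v w hv hb => hp.1.2 ?_,
    fun i v hv hb => hp.2 ?_⟩
  · exact Finset.mem_biUnion.2 ⟨(i, v, w), Finset.mem_univ _, by rw [if_pos ⟨hi, hv⟩]; exact hb⟩
  · exact Finset.mem_biUnion.2 ⟨(i, v, w), Finset.mem_univ _, by rw [if_pos hv]; exact hb⟩
  · exact Finset.mem_biUnion.2 ⟨(i, v), Finset.mem_univ _, by
      rw [if_pos hv]; exact Finset.mem_filter.2 ⟨Finset.mem_univ _, hb⟩⟩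

end RegisterField

theorem cwBit_lt_two (l a b s i x c : ℕ) : cwBit l a b s i x c < 2 := Nat.mod_lt _ two_pos

/-- Each way for a seed to fail exhibits an avoided event: `l + 1` distinct codes near one word, `l
+ 1` independent messages of one code near one word, or a nonzero message with zero codeword. -/
theorem exists_goodSeed {l n a b k V : ℕ} (hb : b ≠ 0) (ha : a ≤ b) (hk : k ≤ b)
    (hn : n + l < 2 ^ b) (hV : ∀ w : Fin b → ZMod 2, (subBall b k w).card ≤ V)
    (hcount : n ^ (l + 1) * (2 ^ a) ^ (l + 1) * 2 ^ b * (V ^ (l + 1) * (2 ^ b) ^ (l + 1)) +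
      n * (2 ^ a) ^ (l + 1) * 2 ^ b * (V ^ (l + 1) * (2 ^ b) ^ (l + 1)) +
      n * 2 ^ a * ((2 ^ b) ^ l * (2 ^ b) ^ (l + 1)) < (2 ^ b) ^ (l + 1) * (2 ^ b) ^ (l + 1)) :
    ∃ s < (2 ^ b) ^ (2 * l + 3), GoodSeed l k n a b s := by
  classical
  obtain ⟨E⟩ := exists_registerField hb
  have : Fintype (GaloisField 2 b) := Fintype.ofFinite _
  obtain ⟨⟨γ, γ'⟩, h1, h2, h3⟩ := E.exists_avoiding ha hn hV hcount
  obtain ⟨s, hs, hword⟩ := E.exists_seed hb γ γ'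
  have hA : 2 ^ b / 2 ^ (b - a) = 2 ^ a := by
    rw [Nat.pow_div (by omega) two_pos, Nat.sub_sub_self ha]
  have hclose : ∀ {w i x : ℕ}, Close b k w (cwBit l a b s i x) →
      E.word γ γ' i (E.emb (bitVec a x)) ∈ E.encMem (subBall b k (bitVec b w)) := by
    intro w i x h
    rw [close_iff (cwBit_lt_two l a b s i x) hk, hword] at h
    exact Finset.mem_filter.2 ⟨Finset.mem_univ _, Finset.mem_filter.2 ⟨Finset.mem_univ _, h⟩⟩
  refine ⟨s, hs, fun w _ => ?_, fun i hi w _ => ?_, fun i hi x hx hx0 => ?_⟩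
  · by_contra! hlt
    obtain ⟨T, hT, hTc⟩ := Finset.exists_subset_card_eq (Nat.succ_le_of_lt hlt)
    let e := T.orderEmbOfFin hTc
    have he : ∀ j, e j < n ∧ ∃ x < 2 ^ b / 2 ^ (b - a), x ≠ 0 ∧
        Close b k w (cwBit l a b s (e j) x) := fun j => by
      simpa using hT (T.orderEmbOfFin_mem hTc j)
    choose hen x hx hx0 hxc using he
    refine h1 (fun j => ⟨e j, hen j⟩) (fun j => bitVec a (x j)) (bitVec b w)
      (fun j j' h => e.injective (Fin.mk.inj h)) (fun j h => hx0 j ?_)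
      (Finset.mem_filter.2 ⟨Finset.mem_univ _, fun j => hclose (hxc j)⟩)
    rw [← bitVec_zero] at h
    exact bitVec_injOn (hA ▸ hx j) (by positivity) h
  · by_contra! hlt
    rw [← Finset.card_image_of_injOn (f := bitVec a) (fun x hx y hy h => bitVec_injOn
      (hA ▸ Finset.mem_range.1 (Finset.mem_filter.1 hx).1)
      (hA ▸ Finset.mem_range.1 (Finset.mem_filter.1 hy).1) h)] at hlt
    obtain ⟨v, hv, hvT⟩ := exists_linearIndependent_of_card hlt
    refine h2 ⟨i, hi⟩ v (bitVec b w) hv (Finset.mem_filter.2 ⟨Finset.mem_univ _, fun j => ?_⟩)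
    obtain ⟨x, hx, hxv⟩ := Finset.mem_image.1 (hvT j)
    rw [← hxv]
    exact hclose (Finset.mem_filter.1 hx).2
  · by_contra! h0
    refine h3 ⟨i, hi⟩ (bitVec a x) (fun h => hx0 ?_) (E.injective ?_)
    · rw [← bitVec_zero] at h
      exact bitVec_injOn (hA ▸ hx) (by positivity) h
    · change E.enc _ = E.enc 0
      rw [← hword]
      funext c
      simp [h0 c c.2, RegisterField.enc]

/-! ### Good seeds give sync sequences -/

/-- The matrices that belong to the seed `s`. -/
def seedMatrix (l n a b s : ℕ) : Fin n → Matrix (Fin a) (Fin b) (ZMod 2) :=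
  fun i r c => (entry l b s i r c : ZMod 2)

theorem vecMul_seedMatrix (l : ℕ) {n a b : ℕ} (s : ℕ) (i : Fin n) (x : ℕ) :
    Matrix.vecMul (bitVec a x) (seedMatrix l n a b s i) =
      fun c : Fin b => (cwBit l a b s i x c : ZMod 2) := by
  funext c
  change ∑ r : Fin a, bitVec a x r * seedMatrix l n a b s i r c = _
  rw [cwBit, ZMod.natCast_mod, Nat.cast_sum, Finset.sum_range]
  refine Finset.sum_congr rfl fun r _ => ?_
  rw [Nat.cast_mul]
  rfl

theorem isSync_of_goodSeed {δ : ℝ} {l n a b k s : ℕ} (ha : a ≤ b) (hk : k ≤ b)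
    (hδ : ⌊δ * b⌋₊ ≤ k) (h : GoodSeed l k n a b s) :
    IsSync δ l (2 ^ (l + 1)) (seedMatrix l n a b s) := by
  classical
  have hA : 2 ^ b / 2 ^ (b - a) = 2 ^ a := by
    rw [Nat.pow_div (by omega) two_pos, Nat.sub_sub_self ha]
  obtain ⟨h1, h2, h3⟩ := h
  rw [hA] at h1 h2 h3
  have hclose : ∀ {i : Fin n} {x w : ℕ} {v : List (ZMod 2)}, bitVec b w ∈ editBall b v (δ * b) →
      Matrix.vecMul (bitVec a x) (seedMatrix l n a b s i) ∈ editBall b v (δ * b) →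
      Close b k w (cwBit l a b s i x) := by
    intro i x w v hw hx
    rw [vecMul_seedMatrix] at hx
    exact (close_iff (cwBit_lt_two l a b s i x) hk).2 (commonSub_of_mem_editBall hδ hw hx)
  refine ⟨?_, fun i v => ?_, fun i => ?_⟩
  · rintro ⟨i, x, v, hi, hx, hball⟩
    choose y hy hyx using fun j => exists_bitVec (x j)
    -- The first codeword takes over the role of the centre `v`; it is close to all of them, itself
    -- included.
    obtain ⟨w, hw, hwx⟩ := exists_bitVec (Matrix.vecMul (x 0) (seedMatrix l n a b s (i 0)))
    refine (Nat.lt_irrefl l) (lt_of_lt_of_le ?_ (h1 w hw))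
    have hcard := Finset.card_le_card_of_injOn (s := Finset.univ) (fun j => (i j : ℕ))
      (t := (Finset.range n).filter fun i => ∃ x < 2 ^ a,
        x ≠ 0 ∧ Close b k w (cwBit l a b s i x)) (fun j _ => ?_)
      (Fin.val_injective.comp hi.injective).injOn
    · simpa using hcard
    · refine Finset.mem_coe.2 (Finset.mem_filter.2 ⟨Finset.mem_range.2 (i j).2, y j, hy j, ?_, ?_⟩)
      · intro h0
        exact hx j (by rw [← hyx, h0, bitVec_zero])
      · exact hclose (by rw [hwx]; exact hball 0) (by rw [hyx]; exact hball j)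
  · rcases (editBall b v (δ * b) ∩ rowCode (seedMatrix l n a b s i)).eq_empty_or_nonempty
      with he | ⟨c, hc⟩
    · rw [he, Set.ncard_empty]; exact Nat.zero_le _
    obtain ⟨w, hw, rfl⟩ := exists_bitVec c
    refine le_trans ?_ (h2 i i.2 w hw)
    refine le_trans ?_ (Finset.card_image_le
      (f := fun x => Matrix.vecMul (bitVec a x) (seedMatrix l n a b s i)))
    rw [← Set.ncard_coe_finset]
    refine Set.ncard_le_ncard ?_ (Finset.finite_toSet _)
    rintro _ ⟨hd, x, rfl⟩
    obtain ⟨y, hy, rfl⟩ := exists_bitVec x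
    exact Finset.mem_coe.2 (Finset.mem_image.2 ⟨y, Finset.mem_filter.2
      ⟨Finset.mem_range.2 hy, hclose hc.1 hd⟩, rfl⟩)
  · rw [min_eq_left ha]
    have hli : LinearIndependent (ZMod 2) (seedMatrix l n a b s i).row := by
      rw [← Matrix.vecMul_injective_iff]
      refine (injective_iff_map_eq_zero
        (Matrix.vecMulLinear (seedMatrix l n a b s i)).toAddMonoidHom).2 fun x hx => ?_
      obtain ⟨y, hy, rfl⟩ := exists_bitVec x
      by_contra hne
      obtain ⟨c, hc, hcw⟩ := h3 i i.2 y hy fun h0 => hne (by rw [h0, bitVec_zero])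
      have hx' : Matrix.vecMul (bitVec a y) (seedMatrix l n a b s i) = 0 := hx
      rw [vecMul_seedMatrix] at hx'
      have h0 := congrArg ZMod.val (congrFun hx' ⟨c, hc⟩)
      rw [val_cast_bit (cwBit_lt_two _ _ _ _ _ _ _)] at h0
      exact hcw h0
    rw [hli.rank_matrix, Fintype.card_fin]

/-- Covers `n = 1`, where the upper bound on `b` forces empty matrices and the union bound is
unavailable. -/
theorem isSync_of_eq_zero (δ : ℝ) (l n : ℕ) (S : Fin n → Matrix (Fin 0) (Fin 0) (ZMod 2)) :
    IsSync δ l (2 ^ (l + 1)) S := by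
  refine ⟨?_, fun i v => ?_, fun i => ?_⟩
  · rintro ⟨i, x, v, -, hx, -⟩
    exact hx 0 (Subsingleton.elim _ _)
  · exact (Set.ncard_le_one_of_subsingleton _).trans Nat.one_le_two_pow
  · have := (S i).rank_le_width
    simp; omega

/-! ### The format of the output -/

theorem bitList_eq_ofFn (k : ℕ) (f : ℕ → ℕ) :
    bitList k f = List.ofFn fun j : Fin k => decide (0 < f j) := by
  rw [bitList, List.ofFn_eq_map, ← List.map_coe_finRange_eq_range, List.map_map]
  rfl

theorem encodeMatrices_eq_bitList {n a b : ℕ} {S : Fin n → Matrix (Fin a) (Fin b) (ZMod 2)}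
    {f : ℕ → ℕ} (h : ∀ i r c, S i r c = 1 ↔ 0 < f (((i : ℕ) * a + r) * b + c)) :
    encodeMatrices S = bitList (n * a * b) f := by
  rw [bitList_eq_ofFn, List.ofFn_mul, List.ofFn_mul, encodeMatrices, List.flatten_flatten,
    List.map_ofFn]
  congr 1
  refine congrArg List.ofFn (funext fun i => ?_)
  simp only [Function.comp_apply]
  congr 1
  refine congrArg List.ofFn (funext fun r => congrArg List.ofFn (funext fun c => ?_))
  exact decide_eq_decide.2 (h i r c)

theorem encodeMatrices_seedMatrix (l u v n a b : ℕ) :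
    encodeMatrices (seedMatrix l n a b (bestSeed l (u * b / v) n a b)) =
      bitList (n * a * b) (outBit l u v ⟨n, a, b⟩) := by
  refine encodeMatrices_eq_bitList fun i r c => ?_
  have hr := r.2
  have hc := c.2
  have e1 : (((i : ℕ) * a + r) * b + c) / b = i * a + r := by
    rw [mul_comm, Nat.mul_add_div (by omega), Nat.div_eq_of_lt hc, add_zero]
  have e2 : (((i : ℕ) * a + r) * b + c) % b = c := by
    rw [mul_comm, Nat.mul_add_mod, Nat.mod_eq_of_lt hc]
  have e3 : ((i : ℕ) * a + r) / a = i := by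
    rw [mul_comm, Nat.mul_add_div (by omega), Nat.div_eq_of_lt hr, add_zero]
  have e4 : ((i : ℕ) * a + r) % a = r := by
    rw [mul_comm, Nat.mul_add_mod, Nat.mod_eq_of_lt hr]
  simp only [outBit]
  rw [mul_comm a b, ← Nat.div_div_eq_div_mul, e1, e2, e3, e4]
  have h1 := entry_le_one l b (bestSeed l (u * b / v) n a b) i r c
  unfold seedMatrix
  generalize entry l b (bestSeed l (u * b / v) n a b) i r c = e at h1
  interval_cases e <;> simp

/-! ### Entropy -/

theorem entropy₂_eq (p : ℝ) : entropy₂ p = Real.binEntropy p / Real.log 2 := by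
  rw [entropy₂, Real.binEntropy, Real.logb, Real.logb, one_div, one_div]
  ring

theorem entropy₂_pos {p : ℝ} (h0 : 0 < p) (h1 : p < 1) : 0 < entropy₂ p := by
  rw [entropy₂_eq]
  exact div_pos (Real.binEntropy_pos h0 h1) (Real.log_pos one_lt_two)

/-- Continuity of the entropy gives a rational rate just above `δ`. Doubling the entropy is
affordable: the ball then has exponent `4 H(δ)`, within the `5 H(δ)` sacrificed in the rate. -/
theorem exists_rational_near {δ : ℝ} (h0 : 0 < δ) (h1 : δ < 1 / 2) :
    ∃ u v : ℕ, 0 < v ∧ δ < (u / v : ℝ) ∧ (u / v : ℝ) < 1 / 2 ∧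
      entropy₂ (u / v : ℝ) ≤ 2 * entropy₂ δ := by
  have hc : Continuous entropy₂ := by
    have : entropy₂ = fun p => Real.binEntropy p / Real.log 2 := funext entropy₂_eq
    rw [this]
    exact Real.binEntropy_continuous.div_const _
  have hpos := entropy₂_pos h0 (by linarith)
  have hev : ∀ᶠ p in nhds δ, entropy₂ p < 2 * entropy₂ δ :=
    hc.continuousAt.eventually_lt continuousAt_const (by linarith)
  obtain ⟨ε, hε, hball⟩ := Metric.eventually_nhds_iff.1 hev
  obtain ⟨q, hq1, hq2⟩ := exists_rat_btwn (lt_min (by linarith : δ < δ + ε) h1)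
  have hq0 : 0 < q := by
    have : (0 : ℝ) < q := h0.trans hq1
    exact_mod_cast this
  have hcast : ((q.num.toNat : ℝ) / (q.den : ℝ)) = q := by
    have h2 : ((q.num.toNat : ℕ) : ℤ) = q.num := Int.toNat_of_nonneg (Rat.num_pos.2 hq0).le
    have h3 := congrArg (fun z : ℤ => (z : ℝ)) h2
    rw [Rat.cast_def, ← h3, Int.cast_natCast]
  refine ⟨q.num.toNat, q.den, q.den_pos, ?_⟩
  rw [hcast]
  refine ⟨hq1, hq2.trans_le (min_le_right _ _), (hball ?_).le⟩
  have := hq2.trans_le (min_le_left _ _)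
  rw [Real.dist_eq, abs_lt]
  constructor <;> linarith

/-- Since `p ≤ 1 - p`, the right side decreases in `k`, and formally at `k = p b` it equals the left
side. -/
theorem rpow_neg_entropy₂_le {p : ℝ} (h0 : 0 < p) (h1 : p ≤ 1 / 2) {b k : ℕ} (hk : k ≤ b)
    (hkp : (k : ℝ) ≤ p * b) :
    (2 : ℝ) ^ (-(entropy₂ p * b)) ≤ p ^ k * (1 - p) ^ (b - k) := by
  have h2 : 0 < 1 - p := by linarith
  have e : p ^ k * (1 - p) ^ (b - k) =
      (2 : ℝ) ^ ((k : ℝ) * Real.logb 2 p + ((b - k : ℕ) : ℝ) * Real.logb 2 (1 - p)) := by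
    rw [Real.rpow_add two_pos, mul_comm (k : ℝ), mul_comm ((b - k : ℕ) : ℝ),
      Real.rpow_mul two_pos.le, Real.rpow_mul two_pos.le,
      Real.rpow_logb two_pos (by norm_num) h0, Real.rpow_logb two_pos (by norm_num) h2,
      Real.rpow_natCast, Real.rpow_natCast]
  rw [e]
  refine Real.rpow_le_rpow_of_exponent_le one_le_two ?_
  have hmono : Real.logb 2 p ≤ Real.logb 2 (1 - p) :=
    Real.logb_le_logb_of_le one_lt_two h0 (by linarith)
  rw [Nat.cast_sub hk, entropy₂, one_div, one_div, Real.logb_inv, Real.logb_inv]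
  nlinarith [mul_nonneg (sub_nonneg.2 hkp) (sub_nonneg.2 hmono)]

theorem card_subBall_le {p : ℝ} (h0 : 0 < p) (h1 : p ≤ 1 / 2) {b k : ℕ} (hk : k ≤ b)
    (hkp : (k : ℝ) ≤ p * b) (w : Fin b → ZMod 2) :
    ((subBall b k w).card : ℝ) ≤ (2 : ℝ) ^ (2 * entropy₂ p * b) := by
  have h2 := rpow_neg_entropy₂_le h0 h1 hk hkp
  have h3 := card_subBall_mul_le h0 h1 hk w
  have hpos : 0 < (2 : ℝ) ^ (-(entropy₂ p * b)) := Real.rpow_pos_of_pos two_pos _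
  have h4 : ((subBall b k w).card : ℝ) * ((2 : ℝ) ^ (-(entropy₂ p * b))) ^ 2 ≤ 1 :=
    (mul_le_mul_of_nonneg_left (pow_le_pow_left₀ hpos.le h2 2) (Nat.cast_nonneg _)).trans h3
  have e : (2 : ℝ) ^ (2 * entropy₂ p * b) * ((2 : ℝ) ^ (-(entropy₂ p * b))) ^ 2 = 1 := by
    rw [← Real.rpow_natCast, ← Real.rpow_mul two_pos.le, ← Real.rpow_add two_pos]
    rw [show 2 * entropy₂ p * (b : ℝ) + -(entropy₂ p * b) * ((2 : ℕ) : ℝ) = 0 by push_cast; ring,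
      Real.rpow_zero]
  rw [← e] at h4
  exact le_of_mul_le_mul_right h4 (pow_pos hpos 2)

/-- The numerical heart of the union bound. -/
theorem union_bound_lt {l n a b V : ℕ} {h : ℝ} (hh : 0 ≤ h) (hl : 1 ≤ l) (hn2 : 2 ≤ n)
    (hn : 4 * ((l : ℝ) + 1) * Real.logb 2 n ≤ b)
    (ha : (a : ℝ) ≤ (1 - 2 / ((l : ℝ) + 1) - 5 * h) * b) (hV : (V : ℝ) ≤ 2 ^ (4 * h * b)) :
    n ^ (l + 1) * (2 ^ a) ^ (l + 1) * 2 ^ b * (V ^ (l + 1) * (2 ^ b) ^ (l + 1)) +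
      n * (2 ^ a) ^ (l + 1) * 2 ^ b * (V ^ (l + 1) * (2 ^ b) ^ (l + 1)) +
      n * 2 ^ a * ((2 ^ b) ^ l * (2 ^ b) ^ (l + 1)) < (2 ^ b) ^ (l + 1) * (2 ^ b) ^ (l + 1) := by
  have hlog : 1 ≤ Real.logb 2 n := by
    rw [Real.le_logb_iff_rpow_le one_lt_two (by positivity), Real.rpow_one]
    exact_mod_cast hn2
  have hl1 : (1 : ℝ) ≤ l := by exact_mod_cast hl
  set m : ℝ := (l : ℝ) + 1 with hm
  have hm0 : 0 < m := by linarith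
  have hb8 : 4 * m ≤ b := by nlinarith
  have hnle : (n : ℝ) ≤ 2 ^ ((b : ℝ) / (4 * m)) := by
    rw [← Real.logb_le_iff_le_rpow one_lt_two (by positivity), le_div_iff₀ (by positivity)]
    linarith
  have hale : ((2 : ℝ) ^ a) ≤ 2 ^ ((1 - 2 / m - 5 * h) * b) := by
    rw [← Real.rpow_natCast]
    exact Real.rpow_le_rpow_of_exponent_le one_le_two ha
  have hpow : ∀ x : ℝ, ((2 : ℝ) ^ x) ^ (l + 1) = 2 ^ (m * x) := by
    intro x
    rw [← Real.rpow_natCast, ← Real.rpow_mul two_pos.le, mul_comm x]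
    push_cast; rfl
  have hA : (n : ℝ) ^ (l + 1) * ((2 : ℝ) ^ a) ^ (l + 1) * 2 ^ b * (V : ℝ) ^ (l + 1) ≤
      ((2 : ℝ) ^ b) ^ (l + 1) * (1 / 4) := by
    calc (n : ℝ) ^ (l + 1) * ((2 : ℝ) ^ a) ^ (l + 1) * 2 ^ b * (V : ℝ) ^ (l + 1)
        ≤ (2 ^ ((b : ℝ) / (4 * m))) ^ (l + 1) * (2 ^ ((1 - 2 / m - 5 * h) * b)) ^ (l + 1) *
          2 ^ (b : ℝ) * (2 ^ (4 * h * b)) ^ (l + 1) := by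
          rw [Real.rpow_natCast]
          gcongr
      _ = 2 ^ (m * ((b : ℝ) / (4 * m)) + m * ((1 - 2 / m - 5 * h) * b) + b +
          m * (4 * h * b)) := by
          rw [hpow, hpow, hpow, ← Real.rpow_add two_pos, ← Real.rpow_add two_pos,
            ← Real.rpow_add two_pos]
      _ ≤ 2 ^ (m * b + (-2)) := by
          -- The exponent is `b/4 + (m b - 2 b - 5 m h b) + b + 4 m h b = m b - 3 b / 4 - m h b`,
          -- and `b ≥ 4 m ≥ 8`. The factor `1 / 4` leaves room for three failure terms.
          refine Real.rpow_le_rpow_of_exponent_le one_le_two ?_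
          have e1 : m * ((b : ℝ) / (4 * m)) = b / 4 := by field_simp
          have e2 : m * ((1 - 2 / m - 5 * h) * b) = m * b - 2 * b - 5 * (m * h * b) := by
            field_simp
          rw [e1, e2]
          have : 0 ≤ m * h * b := by positivity
          nlinarith
      _ = ((2 : ℝ) ^ b) ^ (l + 1) * (1 / 4) := by
          rw [Real.rpow_add two_pos, ← hpow, Real.rpow_natCast]
          norm_num
  have hB : (n : ℝ) * 2 ^ a ≤ 2 ^ b * (1 / 4) := by
    calc (n : ℝ) * 2 ^ a ≤ 2 ^ ((b : ℝ) / (4 * m)) * 2 ^ ((1 - 2 / m - 5 * h) * b) := by gcongr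
      _ = 2 ^ ((b : ℝ) / (4 * m) + (1 - 2 / m - 5 * h) * b) := by rw [← Real.rpow_add two_pos]
      _ ≤ 2 ^ ((b : ℝ) + (-2)) := by
          refine Real.rpow_le_rpow_of_exponent_le one_le_two ?_
          have e : (b : ℝ) / (4 * m) + (1 - 2 / m - 5 * h) * b =
              b - 7 / 4 * (b / m) - 5 * (h * b) := by
            field_simp; ring
          rw [e]
          have h1 : 4 ≤ (b : ℝ) / m := by rw [le_div_iff₀ hm0]; linarith
          have h2 : 0 ≤ h * b := by positivity
          linarith
      _ = 2 ^ b * (1 / 4) := by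
          rw [Real.rpow_add two_pos, Real.rpow_natCast]
          norm_num
  have hC : (n : ℝ) ≤ (n : ℝ) ^ (l + 1) :=
    le_self_pow₀ (by exact_mod_cast (by omega : 1 ≤ n)) (by omega)
  have hN : (0 : ℝ) < 2 ^ b := by positivity
  have key : (n : ℝ) ^ (l + 1) * (2 ^ a) ^ (l + 1) * 2 ^ b * (V ^ (l + 1) * (2 ^ b) ^ (l + 1)) +
      n * (2 ^ a) ^ (l + 1) * 2 ^ b * (V ^ (l + 1) * (2 ^ b) ^ (l + 1)) +
      n * 2 ^ a * ((2 ^ b) ^ l * (2 ^ b) ^ (l + 1)) < (2 ^ b) ^ (l + 1) * (2 ^ b) ^ (l + 1) := by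
    have hP : (0 : ℝ) < ((2 : ℝ) ^ b) ^ (l + 1) := by positivity
    have t1 : (n : ℝ) ^ (l + 1) * (2 ^ a) ^ (l + 1) * 2 ^ b * (V ^ (l + 1) * (2 ^ b) ^ (l + 1)) ≤
        (((2 : ℝ) ^ b) ^ (l + 1) * (1 / 4)) * (2 ^ b) ^ (l + 1) := by
      rw [← mul_assoc]; gcongr
    have t2 : (n : ℝ) * (2 ^ a) ^ (l + 1) * 2 ^ b * (V ^ (l + 1) * (2 ^ b) ^ (l + 1)) ≤
        (n : ℝ) ^ (l + 1) * (2 ^ a) ^ (l + 1) * 2 ^ b * (V ^ (l + 1) * (2 ^ b) ^ (l + 1)) := by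
      gcongr
    have t3 : (n : ℝ) * 2 ^ a * ((2 ^ b) ^ l * (2 ^ b) ^ (l + 1)) ≤
        (((2 : ℝ) ^ b) ^ (l + 1) * (1 / 4)) * (2 ^ b) ^ (l + 1) := by
      calc (n : ℝ) * 2 ^ a * ((2 ^ b) ^ l * (2 ^ b) ^ (l + 1)) ≤
          (2 ^ b * (1 / 4)) * ((2 ^ b) ^ l * (2 ^ b) ^ (l + 1)) := by gcongr
        _ = (((2 : ℝ) ^ b) ^ (l + 1) * (1 / 4)) * (2 ^ b) ^ (l + 1) := by ring
    nlinarith [mul_pos hP hP]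
  exact_mod_cast key

theorem isSync_bestSeed {δ : ℝ} (h0 : 0 < δ) {l : ℕ} (hl : 1 ≤ l) {u v : ℕ}
    (hv : 0 < v) (hδ : δ < (u / v : ℝ)) (huv : (u / v : ℝ) < 1 / 2)
    (hH : entropy₂ (u / v : ℝ) ≤ 2 * entropy₂ δ) {n a b : ℕ} (hn2 : 2 ≤ n)
    (hn : 4 * ((l : ℝ) + 1) * Real.logb 2 n ≤ b)
    (ha : (a : ℝ) ≤ (1 - 2 / ((l : ℝ) + 1) - 5 * entropy₂ δ) * b) (hab : a ≤ b) :
    IsSync δ l (2 ^ (l + 1)) (seedMatrix l n a b (bestSeed l (u * b / v) n a b)) := by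
  have hv' : (0 : ℝ) < v := by exact_mod_cast hv
  set k := u * b / v with hk
  have hkp : (k : ℝ) ≤ (u / v : ℝ) * b := by
    refine (Nat.cast_div_le).trans (le_of_eq ?_)
    push_cast; ring
  have hkb : k ≤ b := by
    have : (k : ℝ) ≤ b := hkp.trans (by nlinarith [(Nat.cast_nonneg b : (0 : ℝ) ≤ b)])
    exact_mod_cast this
  have hfloor : ⌊δ * b⌋₊ ≤ k := by
    rw [hk, Nat.le_div_iff_mul_le hv]
    have h2 : (⌊δ * b⌋₊ : ℝ) ≤ δ * b := Nat.floor_le (by positivity)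
    have h3 : δ * v ≤ u := ((lt_div_iff₀ hv').1 hδ).le
    have : (⌊δ * b⌋₊ : ℝ) * v ≤ u * b := by
      nlinarith [(Nat.cast_nonneg b : (0 : ℝ) ≤ b)]
    exact_mod_cast this
  have hpos := entropy₂_pos h0 (by linarith : δ < 1)
  have hlog : 1 ≤ Real.logb 2 n := by
    rw [Real.le_logb_iff_rpow_le one_lt_two (by positivity), Real.rpow_one]
    exact_mod_cast hn2
  have hb : 4 * (l + 1) ≤ b := by
    have : 4 * ((l : ℝ) + 1) ≤ b := le_trans (by nlinarith) hn
    exact_mod_cast this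
  have hnb : n + l < 2 ^ b := by
    -- Both `n ≤ 2 ^ (b - 1)` and `l < 2 ^ (b - 1)`, which add up to the strict bound.
    have h2 : n ≤ 2 ^ (b - 1) := by
      have h3 : Real.logb 2 n ≤ ((b - 1 : ℕ) : ℝ) := by
        rw [Nat.cast_sub (by omega)]
        have : (8 : ℝ) ≤ b := by exact_mod_cast (by omega : 8 ≤ b)
        have h5 : (1 : ℝ) ≤ l := by exact_mod_cast hl
        push_cast
        nlinarith
      rw [Real.logb_le_iff_le_rpow one_lt_two (by positivity), Real.rpow_natCast] at h3
      exact_mod_cast h3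
    have h4 : l < 2 ^ (b - 1) :=
      Nat.lt_two_pow_self.trans_le (Nat.pow_le_pow_right two_pos (by omega))
    have : 2 ^ b = 2 * 2 ^ (b - 1) := by
      rw [← pow_succ', Nat.sub_add_cancel (by omega)]
    omega
  let V : ℕ := Finset.univ.sup fun w : Fin b → ZMod 2 => (subBall b k w).card
  have hVw : ∀ w : Fin b → ZMod 2, (subBall b k w).card ≤ V := fun w =>
    Finset.le_sup (f := fun w => (subBall b k w).card) (Finset.mem_univ w)
  have hV : (V : ℝ) ≤ 2 ^ (4 * entropy₂ δ * b) := by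
    obtain ⟨w, -, hw⟩ := Finset.exists_mem_eq_sup Finset.univ Finset.univ_nonempty
      fun w : Fin b → ZMod 2 => (subBall b k w).card
    change ((Finset.univ.sup fun w : Fin b → ZMod 2 => (subBall b k w).card : ℕ) : ℝ) ≤ _
    rw [hw]
    refine (card_subBall_le (h0.trans hδ) huv.le hkb hkp w).trans ?_
    refine Real.rpow_le_rpow_of_exponent_le one_le_two ?_
    nlinarith [(Nat.cast_nonneg b : (0 : ℝ) ≤ b)]
  exact isSync_of_goodSeed hab hkb hfloor (leastBelow_spec
    (exists_goodSeed (by omega) hab hkb hnb hVw (union_bound_lt hpos.le hl hn2 hn ha hV)))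

theorem two_pow_le_of_le_log {C : ℝ} {n b : ℕ} (hn : 1 ≤ n) (hb : (b : ℝ) ≤ C * Real.logb 2 n) :
    2 ^ b ≤ n ^ ⌈C⌉₊ := by
  have hn' : (1 : ℝ) ≤ n := by exact_mod_cast hn
  have h1 : (b : ℝ) ≤ ⌈C⌉₊ * Real.logb 2 n :=
    hb.trans (mul_le_mul_of_nonneg_right (Nat.le_ceil C) (Real.logb_nonneg one_lt_two hn'))
  have h2 : (2 : ℝ) ^ b ≤ (n : ℝ) ^ ⌈C⌉₊ := by
    calc (2 : ℝ) ^ b = 2 ^ (b : ℝ) := (Real.rpow_natCast _ _).symm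
      _ ≤ 2 ^ (Real.logb 2 n * ⌈C⌉₊) :=
        Real.rpow_le_rpow_of_exponent_le one_le_two (by linarith)
      _ = (n : ℝ) ^ ⌈C⌉₊ := by
        rw [Real.rpow_mul two_pos.le, Real.rpow_logb two_pos (by norm_num) (by linarith),
          Real.rpow_natCast]
  exact_mod_cast h2

theorem HaltsWithin.mono {M : Turing.TM2ComputableAux Bool Bool} {u w : List Bool} {t t' : ℕ}
    (h : HaltsWithin M u w t) (ht : t ≤ t') : HaltsWithin M u w t' :=
  let ⟨f⟩ := h
  ⟨⟨f.toEvalsTo, f.steps_le_m.trans ht⟩⟩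

end SyncSeq

theorem mainTheorem6 (δ : ℝ) (hδ0 : 0 < δ) (hδ1 : δ < 1 / 2) (l : ℕ) (hl : 1 ≤ l) :
    ∃ M : Turing.TM2ComputableAux Bool Bool,
      (∀ k, Finite (M.tm.Γ k)) ∧
      ∀ C : ℝ, ∃ p : Polynomial ℕ,
        ∀ n a b : ℕ, 1 ≤ n →
          4 * ((l : ℝ) + 1) * Real.logb 2 n ≤ b →
          (b : ℝ) ≤ C * Real.logb 2 n →
          (a : ℝ) ≤ (1 - 2 / ((l : ℝ) + 1) - 5 * SyncSeq.entropy₂ δ) * b →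
          ∃ S : Fin n → Matrix (Fin a) (Fin b) (ZMod 2),
            SyncSeq.IsSync δ l (2 ^ (l + 1)) S ∧
            SyncSeq.HaltsWithin M (SyncSeq.encodeInput n a b) (SyncSeq.encodeMatrices S)
              (p.eval n) := by
  obtain ⟨u, v, hv, hu1, hu2, hH⟩ := SyncSeq.exists_rational_near hδ0 hδ1
  obtain ⟨M, hM, q, hq⟩ := SyncSeq.exists_search_machine l u v
  -- The machine is fixed before `C`; only the polynomial depends on it. As `a ≤ b < 2 ^ b ≤ n ^
  -- ⌈C⌉`, the size `n + a + b + 2 ^ b` is at most `n + 3 n ^ ⌈C⌉`.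
  refine ⟨M, hM, fun C => ⟨q.comp (.X + 3 * .X ^ ⌈C⌉₊), fun n a b hn h1 h2 h3 => ?_⟩⟩
  have hab : a ≤ b := by
    have hpos := SyncSeq.entropy₂_pos hδ0 (by linarith : δ < 1)
    have h4 : 0 ≤ 2 / ((l : ℝ) + 1) := by positivity
    have : (a : ℝ) ≤ b := h3.trans (by nlinarith [(Nat.cast_nonneg b : (0 : ℝ) ≤ b)])
    exact_mod_cast this
  refine ⟨SyncSeq.seedMatrix l n a b (SyncSeq.bestSeed l (u * b / v) n a b), ?_, ?_⟩
  · rcases Nat.lt_or_ge n 2 with hn2 | hn2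
    · obtain rfl : n = 1 := by omega
      have hb : b = 0 := by
        have : (b : ℝ) ≤ 0 := by simpa using h2
        exact_mod_cast le_antisymm this (Nat.cast_nonneg b)
      obtain rfl : a = 0 := by omega
      subst hb
      exact SyncSeq.isSync_of_eq_zero δ l 1 _
    · exact SyncSeq.isSync_bestSeed hδ0 hl hv hu1 hu2 hH hn2 h1 h3 hab
  · rw [SyncSeq.encodeMatrices_seedMatrix]
    refine (hq n a b).mono ?_
    rw [Polynomial.eval_comp]
    refine SyncSeq.eval_mono q ?_
    have h5 := SyncSeq.two_pow_le_of_le_log hn h2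
    have h6 : b < 2 ^ b := Nat.lt_two_pow_self
    simp only [Polynomial.eval_add, Polynomial.eval_mul, Polynomial.eval_pow, Polynomial.eval_X,
      Polynomial.eval_ofNat]
    omega
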